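/- Let $(X,\mathscr B,\mu)$ be a probability space, and let $T,S:X\to X$ be measure preserving automorphisms (invertible, bi-measurable, measure preserving), not assumed to commute. Write $T^nf=f\circ T^n$; let $\mathcal I_T,\mathcal I_S$ be the $\sigma$-algebras of $T$- and $S$-invariant sets, and let $\mathcal K_{\mathrm{rat}}(S)$ be the $\sigma$-algebra generated by the rational eigenfunctions of $S$, i.e. the $\varphi\in L^2(X,\mu)$ with $\varphi\circ S=\zeta\varphi$ a.e. for some root of unity $\zeta$. For $f\in L^2(X,\mu)$ let $\mu_{f,T}$ be the spectral measure of $f$: the unique finite positive Borel measure on $\mathbb R/\mathbb Z$ with $\int e^{2\pi i n\theta}\,d\mu_{f,T}(\theta)=\int_X T^nf\cdot\overline f\,d\mu$ for all $n\ge 0$. Let $\mathcal L$ be Lebesgue measure on $\mathbb R/\mathbb Z$. Let $(k_n)_{n\ge1}$ be a sequence of non-negative integers. Suppose that for all $\alpha\in\mathbb R$ and all integers $h\ge1$ the sequence $((k_{n+h}-k_n)\alpha)_{n\ge1}$, taken modulo $1$, is uniformly distributed in the orbit closure $\overline{\{n\alpha : n\ge 1\}}\subseteq\mathbb R/\mathbb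 Z$, with respect to the normalized Haar measure of that closed subgroup. Then: (i) For all complex-valued $f,g\in L^\infty(X,\mu)$ with $\mu_{f,T}\perp\mathcal L$, $$\lim_{N\to\infty}\frac1N\sum_{n=1}^N T^nf\cdot S^{k_n}g=\mathbb E[f\mid\mathcal I_T]\,\mathbb E[g\mid\mathcal I_S]\quad\text{in }L^2(X,\mu).$$ (ii) For all $A\in\mathscr B$ with $\mu_{\mathbf 1_A,T}\perp\mathcal L$, the following limit exists and satisfies $$\lim_{N\to\infty}\frac1N\sum_{n=1}^N\mu\left(A\cap T^{-n}A\cap S^{-k_n}A\right)\ge\mu(A)^3.$$ (iii) Suppose that instead it is only assumed that $((k_{n+h}-k_n)\alpha)_{n\ge1}$ is uniformly distributed modulo $1$ for all irrational $\alpha$ and all integers $h\ge1$. Then the conclusion of (i) holds for all $f,g\in L^\infty(X,\mu)$ with $\mu_{f,T}\perp\mathcal L$ and $\mathbb E[g\mid\mathcal K_{\mathrm{rat}}(S)]=\mathbb E[g\mid\mathcal I_S]$, and the conclusion of (ii) holds for all $A\in\mathscr B$ with $\mu_{\mathbf 1_A,T}\perp\mathcal L$ and $\mathbb E[\mathbf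 1_A\mid\mathcal K_{\mathrm{rat}}(S)]=\mathbb E[\mathbf 1_A\mid\mathcal I_S]$. Moreover, if $S$ is totally ergodic (that is, $S^n$ is ergodic for every $n\ge1$), then $\mathbb E[g\mid\mathcal K_{\mathrm{rat}}(S)]=\mathbb E[g\mid\mathcal I_S]$ for every $g\in L^\infty(X,\mu)$. -/

import Mathlib

open MeasureTheory Filter Topology
open scoped ENNReal ComplexConjugate

noncomputable section

namespace SpectralVdC

/-! ### Uniform distribution in `ℝ/ℤ` -/

/-- A sequence `x₁, x₂, …` in `ℝ/ℤ` is uniformly distributed with respect to the measure `m` if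
`(1/N) ∑_{n=1}^N φ(xₙ) → ∫ φ dm` for every continuous `φ`. The value `x 0` plays no role. -/
def UniformlyDistributed (m : Measure UnitAddCircle) (x : ℕ → UnitAddCircle) : Prop :=
  ∀ φ : C(UnitAddCircle, ℂ),
    Tendsto (fun N : ℕ => (N : ℂ)⁻¹ * ∑ n ∈ Finset.Icc 1 N, φ (x n)) atTop (𝓝 (∫ y, φ y ∂m))

/-- The orbit closure of `α` in `ℝ/ℤ`, which is a closed subgroup; see `coe_orbitClosure`. -/
def orbitClosure (α : ℝ) : AddSubgroup UnitAddCircle :=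
  (AddSubgroup.zmultiples (α : UnitAddCircle)).topologicalClosure

/-- The subgroup `orbitClosure α` is the closure of `{n α : n = 1, 2, …}`. -/
theorem coe_orbitClosure (α : ℝ) :
    (orbitClosure α : Set UnitAddCircle) =
      closure {y | ∃ n : ℕ, 1 ≤ n ∧ y = n • (α : UnitAddCircle)} := by
  have h0 : (orbitClosure α : Set UnitAddCircle) =
      closure (Set.range fun n : ℤ => n • (α : UnitAddCircle)) := by
    simp only [orbitClosure, AddSubgroup.topologicalClosure_coe, AddSubgroup.coe_zmultiples]
  apply Set.Subset.antisymm
  · intro y hy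
    rw [SetLike.mem_coe, orbitClosure,
      ← mapClusterPt_atTop_nsmul_iff_mem_topologicalClosure_zmultiples] at hy
    rw [mem_closure_iff_clusterPt]
    refine ClusterPt.mono hy (le_principal_iff.2 ?_)
    rw [mem_map]
    filter_upwards [eventually_ge_atTop 1] with n hn
    exact ⟨n, hn, rfl⟩
  · rw [h0]
    apply closure_mono
    rintro y ⟨n, -, rfl⟩
    exact ⟨n, by simp⟩

instance (α : ℝ) : CompactSpace (orbitClosure α) :=
  isCompact_iff_compactSpace.1
    (AddSubgroup.isClosed_topologicalClosure (AddSubgroup.zmultiples (α : UnitAddCircle))).isCompact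

/-- The normalized Haar measure of the compact group `orbitClosure α`, as a measure on `ℝ/ℤ`. -/
def orbitHaar (α : ℝ) : Measure UnitAddCircle :=
  (Measure.addHaarMeasure (⊤ : TopologicalSpace.PositiveCompacts (orbitClosure α))).map
    ((↑) : orbitClosure α → UnitAddCircle)

/-- The sequence `n ↦ (k_{n+h} - k_n) α` in `ℝ/ℤ`. -/
def differenceSeq (k : ℕ → ℕ) (h : ℕ) (α : ℝ) (n : ℕ) : UnitAddCircle :=
  ((((k (n + h) : ℝ) - (k n : ℝ)) * α : ℝ) : UnitAddCircle)

/-! ### Spectral measures -/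

variable {X : Type*} [MeasurableSpace X]

/-- `ν` is a spectral measure of `f` with respect to `T`: a finite Borel measure on `ℝ/ℤ` with
`∫ e^{2πinθ} dν(θ) = ⟨Tⁿf, f⟩` for all `n ≥ 0`. -/
def IsSpectralMeasure (μ : Measure X) (T : X → X) (f : X → ℂ) (ν : Measure UnitAddCircle) : Prop :=
  IsFiniteMeasure ν ∧
    ∀ n : ℕ, ∫ θ, fourier (n : ℤ) θ ∂ν = ∫ x, f (T^[n] x) * conj (f x) ∂μ

theorem IsSpectralMeasure.eq {μ : Measure X} {T : X → X} {f : X → ℂ}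
    {ν ν' : Measure UnitAddCircle} (h : IsSpectralMeasure μ T f ν)
    (h' : IsSpectralMeasure μ T f ν') : ν = ν' := by
  obtain ⟨hν, h⟩ := h
  obtain ⟨hν', h'⟩ := h'
  have key : ∀ n : ℤ, ∫ θ, (fourier n θ : ℂ) ∂ν = ∫ θ, (fourier n θ : ℂ) ∂ν' := by
    intro n
    obtain ⟨m, rfl | rfl⟩ := Int.eq_nat_or_neg n
    · rw [h, h']
    · simp only [fourier_neg]
      rw [integral_conj, integral_conj, h, h']
  have hint : ∀ (ρ : Measure UnitAddCircle) [IsFiniteMeasure ρ] (φ : C(UnitAddCircle, ℂ)),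
      Integrable φ ρ := fun ρ _ φ =>
    (φ.continuous.integrable_of_hasCompactSupport (HasCompactSupport.of_compactSpace _))
  have key2 : ∀ φ ∈ Submodule.span ℂ (Set.range (@fourier 1)),
      ∫ θ, φ θ ∂ν = ∫ θ, φ θ ∂ν' := by
    intro φ hφ
    induction hφ using Submodule.span_induction with
    | mem φ hφ => obtain ⟨n, rfl⟩ := hφ; exact key n
    | zero => simp
    | add φ ψ _ _ h1 h2 =>
      simp only [ContinuousMap.add_apply]
      rw [integral_add (hint _ _) (hint _ _), integral_add (hint _ _) (hint _ _), h1, h2]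
    | smul c φ _ h1 =>
      simp only [ContinuousMap.smul_apply]
      rw [integral_smul, integral_smul, h1]
  refine ext_of_forall_mem_subalgebra_integral_eq_of_pseudoEMetric_complete_countable (𝕜 := ℂ)
    (A := (fourierSubalgebra (T := 1)).comap
      (BoundedContinuousFunction.toContinuousMapStarₐ ℂ)) ?_ ?_
  · intro x y hxy
    obtain ⟨_, ⟨φ, hφ, rfl⟩, h⟩ := fourierSubalgebra_separatesPoints hxy
    exact ⟨_, ⟨φ, ⟨BoundedContinuousFunction.mkOfCompact φ, hφ, rfl⟩, rfl⟩, h⟩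
  · intro g hg
    have hg' : (g : C(UnitAddCircle, ℂ)) ∈ Subalgebra.toSubmodule
      (fourierSubalgebra (T := 1)).toSubalgebra := hg
    rw [fourierSubalgebra_coe] at hg'
    exact key2 _ hg'


theorem integral_fourier_eq_ite (n : ℤ) :
    ∫ θ : UnitAddCircle, (fourier n θ : ℂ) = if n = 0 then 1 else 0 := by
  have h := fourierCoeff_fourier (T := 1) n
  have h2 := congrFun h 0
  simp only [fourierCoeff, neg_zero, fourier_zero, one_smul] at h2
  rw [AddCircle.integral_haarAddCircle] at h2
  simpa [Pi.single_apply, eq_comm] using h2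

section Existence

variable {μ : Measure X} {T : X → X} {f : X → ℂ}

theorem memLp_iterate (hT : MeasurePreserving T μ μ) (hf : MemLp f 2 μ) (n : ℕ) :
    MemLp (fun x => f (T^[n] x)) 2 μ :=
  hf.comp_measurePreserving (hT.iterate n)

theorem integrable_mul_conj {u v : X → ℂ} (hu : MemLp u 2 μ) (hv : MemLp v 2 μ) :
    Integrable (fun x => u x * conj (v x)) μ :=
  hu.integrable_mul hv.star

theorem correlation_shift (hT : MeasurePreserving T μ μ) (hf : MemLp f 2 μ) (j m : ℕ) :
    ∫ x, f (T^[m + j] x) * conj (f (T^[m] x)) ∂μ = ∫ x, f (T^[j] x) * conj (f x) ∂μ := by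
  have h1 : AEStronglyMeasurable (fun x => f (T^[j] x) * conj (f x)) (μ.map T^[m]) := by
    rw [(hT.iterate m).map_eq]
    exact (integrable_mul_conj (memLp_iterate hT hf j) hf).aestronglyMeasurable
  have h2 := integral_map (hT.iterate m).measurable.aemeasurable h1
  rw [(hT.iterate m).map_eq] at h2
  rw [h2]
  congr 1
  ext x
  rw [add_comm m j, Function.iterate_add_apply]

/-- The Fejér-type density `∫ |∑_{n<N} e^{-2πinθ} f(Tⁿx)|² dμ(x) / N`. -/
def fejerDensity (μ : Measure X) (T : X → X) (f : X → ℂ) (N : ℕ) (θ : UnitAddCircle) : ℝ :=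
  (N : ℝ)⁻¹ * ∫ x, ‖∑ n ∈ Finset.range N, (fourier (-(n : ℤ)) θ : ℂ) * f (T^[n] x)‖ ^ 2 ∂μ

theorem fejerDensity_nonneg (N : ℕ) (θ : UnitAddCircle) : 0 ≤ fejerDensity μ T f N θ :=
  mul_nonneg (by positivity) (integral_nonneg fun x => by positivity)

theorem ofReal_fejerDensity (hT : MeasurePreserving T μ μ) (hf : MemLp f 2 μ) (N : ℕ)
    (θ : UnitAddCircle) :
    (fejerDensity μ T f N θ : ℂ) = (N : ℂ)⁻¹ * ∑ n ∈ Finset.range N, ∑ m ∈ Finset.range N,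
      (fourier ((m : ℤ) - n) θ : ℂ) * ∫ x, f (T^[n] x) * conj (f (T^[m] x)) ∂μ := by
  rw [fejerDensity]
  push_cast
  congr 1
  rw [← integral_complex_ofReal]
  have : ∀ x, ((‖∑ n ∈ Finset.range N, (fourier (-(n : ℤ)) θ : ℂ) * f (T^[n] x)‖ ^ 2 : ℝ) : ℂ) =
      ∑ n ∈ Finset.range N, ∑ m ∈ Finset.range N,
        (fourier ((m : ℤ) - n) θ : ℂ) * (f (T^[n] x) * conj (f (T^[m] x))) := by
    intro x
    push_cast
    rw [← Complex.mul_conj', map_sum, Finset.sum_mul_sum]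
    refine Finset.sum_congr rfl fun n _ => Finset.sum_congr rfl fun m _ => ?_
    rw [sub_eq_add_neg, fourier_add, map_mul, ← fourier_neg, neg_neg]
    ring
  simp_rw [this]
  have hi := fun n m => integrable_mul_conj (memLp_iterate hT hf n) (memLp_iterate hT hf m)
  rw [integral_finsetSum _ fun n _ => integrable_finsetSum _ fun m _ => (hi n m).const_mul _]
  refine Finset.sum_congr rfl fun n _ => ?_
  rw [integral_finsetSum _ fun m _ => (hi n m).const_mul _]
  refine Finset.sum_congr rfl fun m _ => ?_
  rw [integral_const_mul]

theorem continuous_fejerDensity (hT : MeasurePreserving T μ μ) (hf : MemLp f 2 μ) (N : ℕ) :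
    Continuous (fejerDensity μ T f N) := by
  have : Continuous fun θ => (fejerDensity μ T f N θ : ℂ) := by
    simp_rw [ofReal_fejerDensity hT hf]
    fun_prop
  exact Complex.continuous_re.comp this

theorem integral_fourier_mul_fejerDensity (hT : MeasurePreserving T μ μ) (hf : MemLp f 2 μ)
    (N j : ℕ) (hj : j ≤ N) :
    ∫ θ : UnitAddCircle, (fejerDensity μ T f N θ : ℂ) * fourier (j : ℤ) θ =
      (N : ℂ)⁻¹ * ((N - j : ℕ) : ℂ) * ∫ x, f (T^[j] x) * conj (f x) ∂μ := by
  have hint : ∀ φ : C(UnitAddCircle, ℂ), Integrable φ := fun φ =>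
    φ.continuous.integrable_of_hasCompactSupport (HasCompactSupport.of_compactSpace _)
  have h1 : ∀ θ : UnitAddCircle, (fejerDensity μ T f N θ : ℂ) * fourier (j : ℤ) θ =
      (N : ℂ)⁻¹ * ∑ n ∈ Finset.range N, ∑ m ∈ Finset.range N,
        (∫ x, f (T^[n] x) * conj (f (T^[m] x)) ∂μ) * fourier ((m : ℤ) - n + j) θ := by
    intro θ
    rw [ofReal_fejerDensity hT hf, mul_assoc, Finset.sum_mul]
    congr 1
    refine Finset.sum_congr rfl fun n _ => ?_
    rw [Finset.sum_mul]
    refine Finset.sum_congr rfl fun m _ => ?_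
    rw [fourier_add]
    ring
  simp_rw [h1]
  rw [integral_const_mul, mul_assoc]
  congr 1
  rw [integral_finsetSum _ fun n _ => integrable_finsetSum _ fun m _ => (hint _).const_mul _]
  simp_rw [integral_finsetSum _ fun m _ => (hint _).const_mul _, integral_const_mul,
    integral_fourier_eq_ite]
  rw [Finset.sum_comm]
  have h2 : ∀ m ∈ Finset.range N, (∑ n ∈ Finset.range N,
      (∫ x, f (T^[n] x) * conj (f (T^[m] x)) ∂μ) * (if (m : ℤ) - n + j = 0 then 1 else 0) : ℂ) =
      if m < N - j then ∫ x, f (T^[j] x) * conj (f x) ∂μ else 0 := by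
    intro m _
    split_ifs with hm
    · rw [Finset.sum_eq_single (m + j), if_pos (by push_cast; ring), mul_one,
        correlation_shift hT hf]
      · intro n _ hn
        rw [if_neg (by omega), mul_zero]
      · intro h
        simp only [Finset.mem_range] at h
        omega
    · refine Finset.sum_eq_zero fun n hn => ?_
      simp only [Finset.mem_range] at hn
      rw [if_neg (by omega), mul_zero]
  rw [Finset.sum_congr rfl h2, ← Finset.sum_filter, Finset.sum_const, nsmul_eq_mul]
  congr 2
  have : (Finset.range N).filter (fun m => m < N - j) = Finset.range (N - j) := by
    ext m; simp only [Finset.mem_filter, Finset.mem_range]; omega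
  rw [this, Finset.card_range]

theorem exists_isSpectralMeasure (hT : MeasurePreserving T μ μ) (hf : MemLp f 2 μ) :
    ∃ ν, IsSpectralMeasure μ T f ν := by
  set c : ℕ → ℂ := fun n => ∫ x, f (T^[n] x) * conj (f x) ∂μ with hc
  have hmeas : ∀ N, Measurable fun θ => ENNReal.ofReal (fejerDensity μ T f N θ) := fun N =>
    (continuous_fejerDensity hT hf N).measurable.ennreal_ofReal
  set ν : ℕ → Measure UnitAddCircle := fun N =>
    volume.withDensity fun θ => ENNReal.ofReal (fejerDensity μ T f N θ) with hν
  have hint : ∀ N, Integrable (fejerDensity μ T f N) (volume : Measure UnitAddCircle) := fun N =>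
    (continuous_fejerDensity hT hf N).integrable_of_hasCompactSupport
      (HasCompactSupport.of_compactSpace _)
  have hfin : ∀ N, IsFiniteMeasure (ν N) := fun N => isFiniteMeasure_withDensity_ofReal (hint N).2
  have hcoef : ∀ N j : ℕ, j ≤ N → ∫ θ, (fourier (j : ℤ) θ : ℂ) ∂(ν N) =
      (N : ℂ)⁻¹ * ((N - j : ℕ) : ℂ) * c j := by
    intro N j hj
    rw [hν, integral_withDensity_eq_integral_toReal_smul (hmeas N) (by simp),
      ← integral_fourier_mul_fejerDensity hT hf N j hj]
    congr 1
    ext θ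
    rw [ENNReal.toReal_ofReal (fejerDensity_nonneg N θ), Complex.real_smul]
  let P : ℕ → FiniteMeasure UnitAddCircle := fun N => ⟨ν N, hfin N⟩
  have hmass : ∀ N, 1 ≤ N → ((P N).mass : ℂ) = c 0 := by
    intro N hN
    have h := hcoef N 0 (Nat.zero_le _)
    have hN' : (N : ℂ) ≠ 0 := by exact_mod_cast (by omega : N ≠ 0)
    simp only [Nat.cast_zero, fourier_zero, Nat.sub_zero, inv_mul_cancel₀ hN', one_mul] at h
    rw [← h, integral_const]
    simp [P, FiniteMeasure.mass, Measure.real]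
    rfl
  have hC : ∀ N, 1 ≤ N → (P N).mass = (P 1).mass := by
    intro N hN
    have := (hmass N hN).trans (hmass 1 le_rfl).symm
    exact_mod_cast this
  have hcomp := isCompact_setOfPred_finiteMeasure_le_of_compactSpace UnitAddCircle (P 1).mass
  let U : Ultrafilter ℕ := Ultrafilter.of atTop
  have hU : (U : Filter ℕ) ≤ atTop := Ultrafilter.of_le _
  obtain ⟨Q, -, hQ⟩ := hcomp.ultrafilter_le_nhds (U.map P) (by
    rw [le_principal_iff]
    have : ∀ᶠ N in (U : Filter ℕ), (P N).mass ≤ (P 1).mass :=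
      hU ((eventually_ge_atTop 1).mono fun N hN => (hC N hN).le)
    exact this)
  have hQ' : Tendsto P U (𝓝 Q) := hQ
  rw [FiniteMeasure.tendsto_iff_forall_integral_rclike_tendsto ℂ] at hQ'
  refine ⟨Q, inferInstance, fun j => ?_⟩
  have h1 := hQ' (BoundedContinuousFunction.mkOfCompact (fourier (j : ℤ)))
  have h2 : Tendsto (fun N : ℕ => (N : ℂ)⁻¹ * ((N - j : ℕ) : ℂ) * c j) atTop (𝓝 (c j)) := by
    have h3 : Tendsto (fun N : ℕ => (1 - (j : ℂ) * (N : ℂ)⁻¹) * c j) atTop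
        (𝓝 ((1 - (j : ℂ) * 0) * c j)) :=
      ((tendsto_const_nhds.sub (tendsto_const_nhds.mul tendsto_inv_atTop_nhds_zero_nat)).mul
        tendsto_const_nhds)
    simp only [mul_zero, sub_zero, one_mul] at h3
    refine h3.congr' ?_
    filter_upwards [eventually_ge_atTop (j + 1)] with N hN
    have hN' : (N : ℂ) ≠ 0 := by exact_mod_cast (by omega : N ≠ 0)
    rw [Nat.cast_sub (by omega)]
    field_simp
  have h4 : Tendsto (fun N : ℕ => ∫ θ, (fourier (j : ℤ) θ : ℂ) ∂(ν N)) U (𝓝 (c j)) := by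
    refine (h2.mono_left hU).congr' ?_
    exact hU ((eventually_ge_atTop j).mono fun N hN => (hcoef N j hN).symm)
  exact tendsto_nhds_unique h1 h4

end Existence

open Classical in
/-- The spectral measure `μ_{f,T}` on `ℝ/ℤ`. It exists for measure preserving `T` and `f ∈ L²`
and is then the unique measure satisfying `IsSpectralMeasure`. -/
def spectralMeasure (μ : Measure X) (T : X → X) (f : X → ℂ) : Measure UnitAddCircle :=
  if h : ∃ ν, IsSpectralMeasure μ T f ν then h.choose else 0

theorem isSpectralMeasure_spectralMeasure {μ : Measure X} {T : X → X} {f : X → ℂ}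
    (hT : MeasurePreserving T μ μ) (hf : MemLp f 2 μ) :
    IsSpectralMeasure μ T f (spectralMeasure μ T f) := by
  have h := exists_isSpectralMeasure hT hf
  rw [spectralMeasure, dif_pos h]
  exact h.choose_spec

/-! ### Rational eigenfunctions and total ergodicity -/

/-- `φ ∈ L²` is a rational eigenfunction of `S` if `φ ∘ S = ζ φ` for some root of unity `ζ`. -/
def IsRationalEigenfunction (μ : Measure X) (S : X → X) (φ : X → ℂ) : Prop :=
  Measurable φ ∧ MemLp φ 2 μ ∧
    ∃ ζ : ℂ, (∃ q : ℕ, 1 ≤ q ∧ ζ ^ q = 1) ∧ ∀ᵐ x ∂μ, φ (S x) = ζ * φ x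

/-- The σ-algebra `K_rat(S)` generated by the rational eigenfunctions of `S`. -/
@[reducible]
def ratKronecker (μ : Measure X) (S : X → X) : MeasurableSpace X :=
  ⨆ φ : {φ : X → ℂ // IsRationalEigenfunction μ S φ}, MeasurableSpace.comap φ.1 (borel ℂ)

theorem ratKronecker_le (μ : Measure X) (S : X → X) :
    ratKronecker μ S ≤ (inferInstance : MeasurableSpace X) := by
  refine iSup_le fun φ => ?_
  rw [← BorelSpace.measurable_eq]
  exact φ.2.1.comap_le

/-- Every positive power of `S` is ergodic. -/
def TotallyErgodic (μ : Measure X) (S : X → X) : Prop :=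
  ∀ n : ℕ, 1 ≤ n → Ergodic S^[n] μ

/-! ### The averages -/

/-- `(1/N) ∑_{n=1}^N Tⁿf · S^{k_n} g`. -/
def productAverage (T S : X → X) (k : ℕ → ℕ) (f g : X → ℂ) (N : ℕ) (x : X) : ℂ :=
  (N : ℂ)⁻¹ * ∑ n ∈ Finset.Icc 1 N, f (T^[n] x) * g (S^[k n] x)

/-- `(1/N) ∑_{n=1}^N Tⁿf · S^{k_n} g → E[f | I_T] E[g | I_S]` in `L²(μ)`. -/
def ProductAveragesConverge (μ : Measure X) (T S : X → X) (k : ℕ → ℕ) (f g : X → ℂ) : Prop :=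
  Tendsto
    (fun N => eLpNorm (fun x => productAverage T S k f g N x -
      (μ[f | MeasurableSpace.invariants T]) x * (μ[g | MeasurableSpace.invariants S]) x) 2 μ)
    atTop (𝓝 0)

/-- The limit of `(1/N) ∑_{n=1}^N μ(A ∩ T⁻ⁿA ∩ S^{-k_n}A)` exists and is at least `μ(A)³`. -/
def RecurrenceAveragesLarge (μ : Measure X) (T S : X → X) (k : ℕ → ℕ) (A : Set X) : Prop :=
  ∃ L : ℝ,
    Tendsto (fun N : ℕ => (N : ℝ)⁻¹ *
      ∑ n ∈ Finset.Icc 1 N, μ.real (A ∩ T^[n] ⁻¹' A ∩ S^[k n] ⁻¹' A)) atTop (𝓝 L) ∧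
    μ.real A ^ 3 ≤ L

end SpectralVdC

end

/-!
Replacing `g` by `g - E[g | I_S]` splits the product averages into two parts. The function
`E[g | I_S]` is strictly `S`-invariant, so the part it contributes is `E[g | I_S]` times an ergodic
average of `f`, and the mean ergodic theorem (`tendsto_eLpNorm_average_sub_condExp`) gives the
claimed limit. It remains to show that the averages of `Tⁿf · uₙ` tend to zero in `L²`, where
`uₙ = S^{k_n} g₀` and `g₀ = g - E[g | I_S]`.

The correlations of `u` vanish on average: `(1/N) ∑ ⟨u_{n+h}, u_n⟩` is the integral of
`(1/N) ∑ e((k_{n+h} - k_n) θ)` against the spectral measure of `g₀`, and the integrand tends to zero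
at every `θ` at which the differences are equidistributed. The exceptional `θ` (only `0`, or the
rationals) are null, because the mass of an atom is controlled by the projection of `g₀` to the
corresponding eigenspace (`IsSpectralMeasure.measure_singleton_eq_zero`), which is zero by the
assumption on conditional expectations.

The remaining step is `tendsto_integral_norm_sq_average_zero`. As the spectral measure of `f` is
singular, there is a trigonometric polynomial that is close to `1` in `L²` of the spectral measure
but whose coefficients have small square sum (`exists_trigPoly_of_mutuallySingular`). By the
spectral isometry, `f` is therefore close in `L²` to a combination `∑ d j • T^j F` of translates of
`F = T^{-K} f` with `∑ |d j|²` small. Summation by shifting the index moves the combination from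
`F` to `u`, after which a pointwise Cauchy–Schwarz inequality leaves the mean square of
`∑ d j • u_{m-j}`. Since the shifts of `u` are asymptotically orthogonal, that is at most
`∑ |d j|²` times a constant.

For recurrence, the limit is `∫_A E[1_A | I_T] E[1_A | I_S]`, bounded below in
`measureReal_pow_three_le`. If `S` is totally ergodic, rational eigenfunctions are invariant under
an ergodic power of `S`, so `K_rat(S)` and `I_S` are both trivial modulo null sets and both
conditional expectations equal `∫ g`.
-/

namespace SpectralVdC

/-! ### Spectral calculus for trigonometric polynomials -/

theorem ofReal_integral_norm_sq_sum {Y ι : Type*} [MeasurableSpace Y] {ν : Measure Y}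
    {φ : ι → Y → ℂ} (hφ : ∀ j, MemLp (φ j) 2 ν) (s : Finset ι) (c : ι → ℂ) :
    ((∫ y, ‖∑ j ∈ s, c j * φ j y‖ ^ 2 ∂ν : ℝ) : ℂ) =
      ∑ j ∈ s, ∑ i ∈ s, c j * conj (c i) * ∫ y, φ j y * conj (φ i y) ∂ν := by
  rw [← integral_complex_ofReal]
  have : ∀ y, ((‖∑ j ∈ s, c j * φ j y‖ ^ 2 : ℝ) : ℂ) =
      ∑ j ∈ s, ∑ i ∈ s, c j * conj (c i) * (φ j y * conj (φ i y)) := by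
    intro y
    push_cast
    rw [← Complex.mul_conj', map_sum, Finset.sum_mul_sum]
    refine Finset.sum_congr rfl fun n _ => Finset.sum_congr rfl fun m _ => ?_
    rw [map_mul]
    ring
  simp_rw [this]
  have hi := fun n m => integrable_mul_conj (hφ n) (hφ m)
  rw [integral_finsetSum _ fun n _ => integrable_finsetSum _ fun m _ => (hi n m).const_mul _]
  refine Finset.sum_congr rfl fun n _ => ?_
  rw [integral_finsetSum _ fun m _ => (hi n m).const_mul _]
  refine Finset.sum_congr rfl fun m _ => ?_
  rw [integral_const_mul]

theorem memLp_continuousMap {Y : Type*} [MeasurableSpace Y] [TopologicalSpace Y] [BorelSpace Y]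
    [CompactSpace Y] [SecondCountableTopology Y] (ν : Measure Y) [IsFiniteMeasure ν] (φ : C(Y, ℂ))
    (p : ℝ≥0∞) : MemLp φ p ν :=
  MemLp.of_bound φ.continuous.aestronglyMeasurable ‖φ‖ (ae_of_all _ φ.norm_coe_le_norm)

variable {X : Type*} [MeasurableSpace X] {μ : Measure X} {T : X → X} {f : X → ℂ}
  {ν : Measure UnitAddCircle}

theorem IsSpectralMeasure.integral_iterate_mul_conj (hν : IsSpectralMeasure μ T f ν)
    (hT : MeasurePreserving T μ μ) (hf : MemLp f 2 μ) (i j : ℕ) :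
    ∫ x, f (T^[j] x) * conj (f (T^[i] x)) ∂μ = ∫ θ, (fourier ((j : ℤ) - i) θ : ℂ) ∂ν := by
  rcases le_total i j with h | h
  · obtain ⟨d, rfl⟩ := Nat.exists_eq_add_of_le h
    rw [correlation_shift hT hf, ← hν.2]
    simp
  · obtain ⟨d, rfl⟩ := Nat.exists_eq_add_of_le h
    have h1 := congrArg conj (correlation_shift hT hf d j)
    rw [← hν.2, ← integral_conj, ← integral_conj] at h1
    simp only [map_mul, Complex.conj_conj, ← fourier_neg] at h1
    calc _ = _ := by congr 1; ext x; exact mul_comm _ _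
      _ = _ := h1
      _ = _ := by simp

/-- The map `e_j ↦ f ∘ T^j` extends to an isometry from trigonometric polynomials in `L²` of the
spectral measure to `L²(μ)`. -/
theorem IsSpectralMeasure.integral_norm_sq_sum (hν : IsSpectralMeasure μ T f ν)
    (hT : MeasurePreserving T μ μ) (hf : MemLp f 2 μ) (s : Finset ℕ) (c : ℕ → ℂ) :
    ∫ x, ‖∑ j ∈ s, c j * f (T^[j] x)‖ ^ 2 ∂μ =
      ∫ θ, ‖∑ j ∈ s, c j * (fourier (j : ℤ) θ : ℂ)‖ ^ 2 ∂ν := by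
  have := hν.1
  apply Complex.ofReal_injective
  rw [ofReal_integral_norm_sq_sum (fun j => memLp_iterate hT hf j),
    ofReal_integral_norm_sq_sum (fun j : ℕ => memLp_continuousMap ν (fourier (j : ℤ)) 2)]
  refine Finset.sum_congr rfl fun n _ => Finset.sum_congr rfl fun m _ => ?_
  rw [hν.integral_iterate_mul_conj hT hf]
  simp only [← fourier_neg, ← fourier_add, sub_eq_add_neg]

theorem integral_norm_sq_sum_fourier (s : Finset ℕ) (c : ℕ → ℂ) :
    ∫ θ : UnitAddCircle, ‖∑ j ∈ s, c j * (fourier (j : ℤ) θ : ℂ)‖ ^ 2 = ∑ j ∈ s, ‖c j‖ ^ 2 := by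
  apply Complex.ofReal_injective
  rw [ofReal_integral_norm_sq_sum (fun j : ℕ => memLp_continuousMap volume (fourier (j : ℤ)) 2)]
  simp only [← fourier_neg, ← fourier_add, integral_fourier_eq_ite]
  push_cast
  refine Finset.sum_congr rfl fun n hn => ?_
  rw [Finset.sum_eq_single n, if_pos (by ring), mul_one, Complex.mul_conj']
  · intro m _ hm
    rw [if_neg (by omega), mul_zero]
  · exact fun h => absurd hn h

/-- If `ν` is singular, some trigonometric polynomial is close to `1` in `L²(ν)` and close to `0`
in `L²` of Lebesgue measure. -/
theorem exists_mem_span_fourier [IsFiniteMeasure ν] (hν : ν ⟂ₘ volume) {ε : ℝ} (hε : 0 < ε) :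
    ∃ P ∈ Submodule.span ℂ (Set.range (@fourier 1)),
      ∫ θ, ‖1 - P θ‖ ^ 2 ∂ν ≤ ε ∧ ∫ θ : UnitAddCircle, ‖P θ‖ ^ 2 ≤ ε := by
  obtain ⟨s, hs, hνs, hvs⟩ := hν
  set ρ : Measure UnitAddCircle := ν + volume with hρ
  -- `φ` equals `1` almost everywhere for `ν` and `0` almost everywhere for Lebesgue measure.
  set φ : UnitAddCircle → ℂ := sᶜ.indicator fun _ => 1 with hφ
  have hφm : MemLp φ (ENNReal.ofReal 2) ρ :=
    memLp_indicator_const _ hs.compl _ (Or.inr (measure_ne_top _ _))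
  obtain ⟨g, -, hg, hgc, -⟩ :=
    hφm.exists_hasCompactSupport_integral_rpow_sub_le two_pos (show 0 < ε / 4 by positivity)
  have hM : 0 ≤ ρ.real Set.univ := measureReal_nonneg
  set δ : ℝ := √(ε / (4 * (ρ.real Set.univ + 1))) with hδ
  have hδ0 : 0 < δ := Real.sqrt_pos.2 (by positivity)
  have hδ2 : δ ^ 2 * ρ.real Set.univ ≤ ε / 4 := by
    rw [hδ, Real.sq_sqrt (by positivity), div_mul_eq_mul_div, div_le_div_iff₀ (by positivity)
      (by norm_num)]
    nlinarith
  have hdense : (⟨g, hgc⟩ : C(UnitAddCircle, ℂ)) ∈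
      closure (Submodule.span ℂ (Set.range (@fourier 1)) : Set C(UnitAddCircle, ℂ)) := by
    rw [← Submodule.topologicalClosure_coe, span_fourier_closure_eq_top]
    trivial
  obtain ⟨P, hP, hgP⟩ := Metric.mem_closure_iff.1 hdense δ hδ0
  have hPm : MemLp P (ENNReal.ofReal 2) ρ := memLp_continuousMap ρ P _
  have hgm : MemLp g (ENNReal.ofReal 2) ρ := memLp_continuousMap ρ ⟨g, hgc⟩ _
  simp only [ENNReal.ofReal_ofNat] at hφm hPm hgm
  have hint : Integrable (fun θ => ‖φ θ - P θ‖ ^ 2) ρ := (hφm.sub hPm).norm.integrable_sq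
  have hint2 : Integrable (fun θ => ‖φ θ - g θ‖ ^ 2) ρ := (hφm.sub hgm).norm.integrable_sq
  have hpt : ∀ θ, ‖φ θ - P θ‖ ^ 2 ≤ 2 * ‖φ θ - g θ‖ ^ 2 + 2 * δ ^ 2 := by
    intro θ
    have h1 : ‖g θ - P θ‖ ≤ δ := by
      have := ContinuousMap.dist_apply_le_dist (f := ⟨g, hgc⟩) (g := P) θ
      rw [dist_eq_norm] at this
      exact this.trans hgP.le
    have h2 : ‖φ θ - P θ‖ ≤ ‖φ θ - g θ‖ + δ := by
      calc _ = ‖(φ θ - g θ) + (g θ - P θ)‖ := by ring_nf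
        _ ≤ _ := (norm_add_le _ _).trans (by gcongr)
    calc _ ≤ (‖φ θ - g θ‖ + δ) ^ 2 := by gcongr
      _ ≤ _ := by nlinarith [sq_nonneg (‖φ θ - g θ‖ - δ)]
  have hmain : ∫ θ, ‖φ θ - P θ‖ ^ 2 ∂ρ ≤ ε := by
    calc _ ≤ ∫ θ, (2 * ‖φ θ - g θ‖ ^ 2 + 2 * δ ^ 2) ∂ρ :=
          integral_mono hint ((hint2.const_mul _).add (integrable_const _)) hpt
      _ = 2 * ∫ θ, ‖φ θ - g θ‖ ^ 2 ∂ρ + 2 * (δ ^ 2 * ρ.real Set.univ) := by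
          rw [integral_add (hint2.const_mul _) (integrable_const _), integral_const_mul,
            integral_const, smul_eq_mul]
          ring
      _ ≤ ε := by
          simp only [Real.rpow_ofNat] at hg
          linarith
  rw [hρ, integral_add_measure hint.left_of_add_measure hint.right_of_add_measure] at hmain
  have e1 : ∫ θ, ‖φ θ - P θ‖ ^ 2 ∂ν = ∫ θ, ‖1 - P θ‖ ^ 2 ∂ν := by
    refine integral_congr_ae ?_
    filter_upwards [measure_eq_zero_iff_ae_notMem.1 hνs] with θ hθ
    simp [φ, hθ]
  have e2 : ∫ θ, ‖φ θ - P θ‖ ^ 2 = ∫ θ : UnitAddCircle, ‖P θ‖ ^ 2 := by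
    refine integral_congr_ae ?_
    filter_upwards [measure_eq_zero_iff_ae_notMem.1 hvs] with θ hθ
    rw [hφ, Set.indicator_of_notMem hθ, zero_sub, norm_neg]
  have p1 : 0 ≤ ∫ θ, ‖φ θ - P θ‖ ^ 2 ∂ν := integral_nonneg fun _ => by positivity
  have p2 : 0 ≤ ∫ θ, ‖φ θ - P θ‖ ^ 2 := integral_nonneg fun _ => by positivity
  exact ⟨P, hP, by linarith, by linarith⟩

/-- The polynomial of `exists_mem_span_fourier`, multiplied by a character `e_K` so that all its
frequencies become nonnegative. -/
theorem exists_trigPoly_of_mutuallySingular [IsFiniteMeasure ν] (hν : ν ⟂ₘ volume) {ε : ℝ}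
    (hε : 0 < ε) :
    ∃ (K J : ℕ) (d : ℕ → ℂ), K < J ∧
      ∫ θ, ‖(fourier (K : ℤ) θ : ℂ) - ∑ j ∈ Finset.range J, d j * fourier (j : ℤ) θ‖ ^ 2 ∂ν ≤ ε ∧
      ∑ j ∈ Finset.range J, ‖d j‖ ^ 2 ≤ ε := by
  obtain ⟨P, hP, h1, h2⟩ := exists_mem_span_fourier hν hε
  obtain ⟨c, hc⟩ := Finsupp.mem_span_range_iff_exists_finsupp.1 hP
  obtain ⟨K, hK⟩ : ∃ K : ℕ, ∀ i ∈ c.support, -(K : ℤ) ≤ i ∧ i ≤ K := by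
    refine ⟨c.support.sup Int.natAbs, fun i hi => ?_⟩
    have := Finset.le_sup (f := Int.natAbs) hi
    omega
  have hexp : ∀ θ, ∑ j ∈ Finset.range (2 * K + 1), c ((j : ℤ) - K) * (fourier (j : ℤ) θ : ℂ) =
      fourier (K : ℤ) θ * P θ := by
    intro θ
    have hPθ : P θ = ∑ i ∈ c.support, c i * (fourier i θ : ℂ) := by
      rw [← hc, Finsupp.sum, ContinuousMap.coe_sum, Finset.sum_apply]
      rfl
    have hsub : c.support ⊆ Finset.Icc (-(K : ℤ)) K := fun i hi => Finset.mem_Icc.2 (hK i hi)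
    rw [hPθ, Finset.sum_subset hsub (fun i _ hi => by
      rw [Finsupp.notMem_support_iff.1 hi, zero_mul]), Finset.mul_sum]
    refine Finset.sum_bij' (fun j _ => (j : ℤ) - K) (fun i _ => (i + K).toNat) ?_ ?_ ?_ ?_ ?_
    · intro j hj
      simp only [Finset.mem_range, Finset.mem_Icc] at *
      omega
    · intro i hi
      simp only [Finset.mem_range, Finset.mem_Icc] at *
      omega
    · intro j _
      simp
    · intro i hi
      simp only [Finset.mem_Icc] at hi
      omega
    · intro j _
      rw [mul_left_comm, ← fourier_add]
      simp
  have hn : ∀ (θ : UnitAddCircle) (z : ℂ), ‖(fourier (K : ℤ) θ : ℂ) * z‖ = ‖z‖ := by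
    intro θ z
    rw [norm_mul, fourier_apply, Circle.norm_coe, one_mul]
  -- The factor `e_K` has modulus one, so neither `L²` distance changes.
  refine ⟨K, 2 * K + 1, fun j => c ((j : ℤ) - K), by omega, ?_, ?_⟩
  · simp_rw [hexp]
    have : ∀ θ : UnitAddCircle, (fourier (K : ℤ) θ : ℂ) - fourier (K : ℤ) θ * P θ =
      fourier (K : ℤ) θ * (1 - P θ) := fun θ => by ring
    simp_rw [this, hn]
    exact h1
  · rw [← integral_norm_sq_sum_fourier]
    simp_rw [hexp, hn]
    exact h2

end SpectralVdC

namespace SpectralVdC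

/-! ### The van der Corput estimate -/

theorem norm_sq_sum_mul_le {ι : Type*} (s : Finset ι) (a b : ι → ℂ) :
    ‖∑ i ∈ s, a i * b i‖ ^ 2 ≤ (∑ i ∈ s, ‖a i‖ ^ 2) * ∑ i ∈ s, ‖b i‖ ^ 2 := by
  have h1 : ‖∑ i ∈ s, a i * b i‖ ≤ ∑ i ∈ s, ‖a i‖ * ‖b i‖ :=
    (norm_sum_le _ _).trans_eq (Finset.sum_congr rfl fun _ _ => norm_mul _ _)
  exact (pow_le_pow_left₀ (norm_nonneg _) h1 2).trans (Finset.sum_mul_sq_le_sq_mul_sq s _ _)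

variable {X : Type*}

/-- The sequence `u 1, …, u N`, extended by zero and shifted `j` places to the right. -/
def truncShift (u : ℕ → X → ℂ) (N j m : ℕ) (x : X) : ℂ :=
  if j + 1 ≤ m ∧ m ≤ j + N then u (m - j) x else 0

theorem truncShift_of_mem (u : ℕ → X → ℂ) {N j m : ℕ} (h : j + 1 ≤ m ∧ m ≤ j + N) :
    truncShift u N j m = u (m - j) :=
  funext fun _ => if_pos h

theorem truncShift_of_notMem (u : ℕ → X → ℂ) {N j m : ℕ} (h : ¬ (j + 1 ≤ m ∧ m ≤ j + N)) :
    truncShift u N j m = 0 :=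
  funext fun _ => if_neg h

/-- Truncating `u` makes summation by shifting the index exact, with no boundary terms. -/
theorem sum_mul_sum_shift (u : ℕ → X → ℂ) (N J : ℕ) (d a : ℕ → ℂ) (x : X) :
    ∑ n ∈ Finset.Icc 1 N, (∑ j ∈ Finset.range J, d j * a (n + j)) * u n x =
      ∑ m ∈ Finset.range (N + J + 1), a m *
        ∑ j ∈ Finset.range J, d j * truncShift u N j m x := by
  simp_rw [Finset.sum_mul, Finset.mul_sum]
  rw [Finset.sum_comm, Finset.sum_comm (s := Finset.range (N + J + 1))]
  refine Finset.sum_congr rfl fun j hj => ?_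
  have hj := Finset.mem_range.1 hj
  have hsub : Finset.Icc (j + 1) (j + N) ⊆ Finset.range (N + J + 1) := fun m hm => by
    simp only [Finset.mem_Icc, Finset.mem_range] at *
    omega
  rw [← Finset.sum_subset hsub fun m _ hm => by
    rw [Finset.mem_Icc] at hm
    rw [truncShift, if_neg hm, mul_zero, mul_zero]]
  refine Finset.sum_nbij' (· + j) (· - j) ?_ ?_ ?_ ?_ ?_
  · intro n hn
    simp only [Finset.mem_Icc] at *
    omega
  · intro n hn
    simp only [Finset.mem_Icc] at *
    omega
  · intro n hn
    simp
  · intro n hn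
    simp only [Finset.mem_Icc] at *
    omega
  · intro n hn
    simp only [Finset.mem_Icc] at hn
    rw [truncShift, if_pos (by omega), Nat.add_sub_cancel]
    ring

variable [MeasurableSpace X] {μ : Measure X}

/-- The product of the shifts by `i + h` and `i` is supported on `i + h < m ≤ i + N`; this leaves the
correlations of lag `h` at the indices `1, …, N - h`. -/
theorem sum_integral_truncShift (u : ℕ → X → ℂ) {N J i h : ℕ} (hi : i + h < J) :
    ∑ m ∈ Finset.range (N + J + 1),
        ∫ x, truncShift u N (i + h) m x * conj (truncShift u N i m x) ∂μ =
      ∑ n ∈ Finset.Icc 1 (N - h), ∫ x, u n x * conj (u (n + h) x) ∂μ := by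
  have hsub : Finset.Icc (i + h + 1) (i + N) ⊆ Finset.range (N + J + 1) := fun m hm => by
    simp only [Finset.mem_Icc, Finset.mem_range] at *
    omega
  rw [← Finset.sum_subset hsub]
  · refine Finset.sum_nbij' (· - (i + h)) (· + (i + h)) ?_ ?_ ?_ ?_ ?_
    · intro m hm
      simp only [Finset.mem_Icc] at *
      omega
    · intro m hm
      simp only [Finset.mem_Icc] at *
      omega
    · intro m hm
      simp only [Finset.mem_Icc] at *
      omega
    · intro m hm
      simp
    · intro m hm
      simp only [Finset.mem_Icc] at hm
      rw [truncShift_of_mem u (by omega), truncShift_of_mem u (by omega),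
        show m - (i + h) + h = m - i by omega]
  · intro m _ hm
    rw [Finset.mem_Icc] at hm
    by_cases h1 : i + h + 1 ≤ m ∧ m ≤ i + h + N
    · have h2 : ¬ (i + 1 ≤ m ∧ m ≤ i + N) := by omega
      simp [truncShift_of_notMem u h2]
    · simp [truncShift_of_notMem u h1]

theorem memLp_truncShift {u : ℕ → X → ℂ} {p : ℝ≥0∞} (hu : ∀ n, MemLp (u n) p μ) (N j m : ℕ) :
    MemLp (truncShift u N j m) p μ := by
  by_cases h : j + 1 ≤ m ∧ m ≤ j + N
  · rw [truncShift_of_mem u h]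
    exact hu (m - j)
  · rw [truncShift_of_notMem u h]
    exact MemLp.zero

section Correlations

variable {u : ℕ → X → ℂ} {C : ℝ}

theorem norm_integral_mul_conj_self_le [IsProbabilityMeasure μ] {v : X → ℂ}
    (hv : ∀ᵐ x ∂μ, ‖v x‖ ≤ C) : ‖∫ x, v x * conj (v x) ∂μ‖ ≤ C ^ 2 := by
  refine (norm_integral_le_of_norm_le_const (C := C ^ 2) ?_).trans (by simp)
  filter_upwards [hv] with x hx
  rw [norm_mul, RCLike.norm_conj, ← sq]
  gcongr

theorem norm_sum_integral_truncShift_self_le [IsProbabilityMeasure μ]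
    (hC : ∀ n, ∀ᵐ x ∂μ, ‖u n x‖ ≤ C) {J j : ℕ} (hj : j < J) (N : ℕ) :
    ‖(N : ℂ)⁻¹ * ∑ m ∈ Finset.range (N + J + 1),
      ∫ x, truncShift u N j m x * conj (truncShift u N j m x) ∂μ‖ ≤ C ^ 2 := by
  have h := sum_integral_truncShift (μ := μ) u (N := N) (J := J) (i := j) (h := 0) hj
  simp only [add_zero, Nat.sub_zero] at h
  rw [h, norm_mul, norm_inv, Complex.norm_natCast]
  have h2 : ‖∑ n ∈ Finset.Icc 1 N, ∫ x, u n x * conj (u n x) ∂μ‖ ≤ N * C ^ 2 := by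
    refine (norm_sum_le_of_le _ fun n _ => norm_integral_mul_conj_self_le (hC n)).trans ?_
    simp
  rcases Nat.eq_zero_or_pos N with rfl | hN
  · simpa using sq_nonneg C
  · rw [inv_mul_le_iff₀ (by exact_mod_cast hN)]
    exact h2

theorem tendsto_sum_integral_truncShift
    (hu : ∀ h : ℕ, 1 ≤ h → Tendsto (fun N : ℕ => (N : ℂ)⁻¹ *
      ∑ n ∈ Finset.Icc 1 N, ∫ x, u (n + h) x * conj (u n x) ∂μ) atTop (𝓝 0))
    {J i j : ℕ} (hi : i < J) (hj : j < J) (hij : i ≠ j) :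
    Tendsto (fun N : ℕ => (N : ℂ)⁻¹ * ∑ m ∈ Finset.range (N + J + 1),
      ∫ x, truncShift u N j m x * conj (truncShift u N i m x) ∂μ) atTop (𝓝 0) := by
  wlog hlt : i < j generalizing i j
  · have h1 := this hj hi hij.symm (by omega)
    have h2 := (Complex.continuous_conj.tendsto _).comp h1
    rw [map_zero] at h2
    refine h2.congr fun N => ?_
    simp only [Function.comp_apply, map_mul, map_sum, map_inv₀, map_natCast, ← integral_conj,
      Complex.conj_conj]
    simp_rw [mul_comm (conj _)]
  obtain ⟨h, rfl⟩ := Nat.exists_eq_add_of_le hlt.le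
  have h1 := ((hu h (by omega)).comp (tendsto_sub_atTop_nat h)).norm
  rw [norm_zero] at h1
  refine squeeze_zero_norm' ?_ h1
  filter_upwards [eventually_gt_atTop h] with N hN
  rw [sum_integral_truncShift u hj, Function.comp_apply, norm_mul, norm_mul]
  have h3 : ‖∑ n ∈ Finset.Icc 1 (N - h), ∫ x, u n x * conj (u (n + h) x) ∂μ‖ =
      ‖∑ n ∈ Finset.Icc 1 (N - h), ∫ x, u (n + h) x * conj (u n x) ∂μ‖ := by
    rw [← RCLike.norm_conj, map_sum]
    simp only [← integral_conj, map_mul, Complex.conj_conj]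
    simp_rw [mul_comm (conj _)]
  rw [h3]
  gcongr
  rw [norm_inv, norm_inv, Complex.norm_natCast, Complex.norm_natCast]
  have : (0 : ℝ) < (N - h : ℕ) := by exact_mod_cast Nat.sub_pos_of_lt hN
  gcongr
  exact Nat.sub_le _ _

/-- If the correlations of `u` vanish on average, the truncated shifts of `u` are asymptotically
orthogonal, so a combination of them has mean square at most `C² ∑ |d j|²` in the limit. -/
theorem eventually_sum_integral_norm_sq_truncShift_le [IsProbabilityMeasure μ]
    (hm : ∀ n, AEStronglyMeasurable (u n) μ) (hC : ∀ n, ∀ᵐ x ∂μ, ‖u n x‖ ≤ C)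
    (hu : ∀ h : ℕ, 1 ≤ h → Tendsto (fun N : ℕ => (N : ℂ)⁻¹ *
      ∑ n ∈ Finset.Icc 1 N, ∫ x, u (n + h) x * conj (u n x) ∂μ) atTop (𝓝 0))
    (J : ℕ) (d : ℕ → ℂ) {ε : ℝ} (hε : 0 < ε) :
    ∀ᶠ N : ℕ in atTop, (N : ℝ)⁻¹ * ∑ m ∈ Finset.range (N + J + 1),
      ∫ x, ‖∑ j ∈ Finset.range J, d j * truncShift u N j m x‖ ^ 2 ∂μ ≤
        (∑ j ∈ Finset.range J, ‖d j‖ ^ 2) * C ^ 2 + ε := by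
  set A : ℕ → ℕ → ℕ → ℂ := fun N j i => (N : ℂ)⁻¹ * ∑ m ∈ Finset.range (N + J + 1),
      ∫ x, truncShift u N j m x * conj (truncShift u N i m x) ∂μ with hA
  have hmem : ∀ n, MemLp (u n) 2 μ := fun n => MemLp.of_bound (hm n) C (hC n)
  have hlim : Tendsto (fun N => ∑ j ∈ Finset.range J, ∑ i ∈ Finset.range J,
      if i = j then ‖d j‖ ^ 2 * C ^ 2 else ‖d j‖ * ‖d i‖ * ‖A N j i‖) atTop
      (𝓝 (∑ j ∈ Finset.range J, ∑ i ∈ Finset.range J,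
        if i = j then ‖d j‖ ^ 2 * C ^ 2 else 0)) := by
    refine tendsto_finsetSum _ fun j hj => tendsto_finsetSum _ fun i hi => ?_
    split_ifs with h
    · exact tendsto_const_nhds
    · have := (tendsto_sum_integral_truncShift hu (Finset.mem_range.1 hi)
        (Finset.mem_range.1 hj) h).norm.const_mul (‖d j‖ * ‖d i‖)
      rwa [norm_zero, mul_zero] at this
  have hval : (∑ j ∈ Finset.range J, ∑ i ∈ Finset.range J,
      if i = j then ‖d j‖ ^ 2 * C ^ 2 else 0) = (∑ j ∈ Finset.range J, ‖d j‖ ^ 2) * C ^ 2 := by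
    rw [Finset.sum_mul]
    refine Finset.sum_congr rfl fun j hj => ?_
    rw [Finset.sum_ite_eq' _ j, if_pos hj]
  rw [hval] at hlim
  filter_upwards [hlim.eventually_le_const (lt_add_of_pos_right _ hε)] with N hN
  refine le_trans ?_ hN
  have hexp : (((N : ℝ)⁻¹ * ∑ m ∈ Finset.range (N + J + 1),
      ∫ x, ‖∑ j ∈ Finset.range J, d j * truncShift u N j m x‖ ^ 2 ∂μ : ℝ) : ℂ) =
      ∑ j ∈ Finset.range J, ∑ i ∈ Finset.range J, d j * conj (d i) * A N j i := by
    rw [Complex.ofReal_mul, Complex.ofReal_sum]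
    simp_rw [ofReal_integral_norm_sq_sum (fun j => memLp_truncShift hmem N j _)]
    push_cast
    rw [Finset.sum_comm, Finset.mul_sum]
    refine Finset.sum_congr rfl fun j _ => ?_
    rw [Finset.sum_comm, Finset.mul_sum]
    refine Finset.sum_congr rfl fun i _ => ?_
    rw [← Finset.mul_sum, hA]
    ring
  calc _ ≤ ‖(((N : ℝ)⁻¹ * ∑ m ∈ Finset.range (N + J + 1),
      ∫ x, ‖∑ j ∈ Finset.range J, d j * truncShift u N j m x‖ ^ 2 ∂μ : ℝ) : ℂ)‖ := by
        rw [Complex.norm_real]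
        exact le_abs_self _
    _ ≤ _ := by
        rw [hexp]
        refine norm_sum_le_of_le _ fun j hj => norm_sum_le_of_le _ fun i _ => ?_
        rw [norm_mul, norm_mul, RCLike.norm_conj]
        split_ifs with h
        · subst h
          rw [← sq]
          gcongr
          exact norm_sum_integral_truncShift_self_le hC (Finset.mem_range.1 hj) N
        · exact le_rfl

end Correlations

theorem integral_comp_measurePreserving {E : Type*} [NormedAddCommGroup E] [NormedSpace ℝ E]
    {φ : X → X} (hφ : MeasurePreserving φ μ μ) {g : X → E} (hg : AEStronglyMeasurable g μ) :
    ∫ x, g (φ x) ∂μ = ∫ x, g x ∂μ := by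
  have h := integral_map hφ.measurable.aemeasurable (hφ.map_eq.symm ▸ hg)
  rw [← h, hφ.map_eq]

/-- As `T` is invertible, the correlations of `f` and of its translate `f ∘ T⁻ᴷ` agree. -/
theorem isSpectralMeasure_comp_symm_iterate {T : X ≃ᵐ X} (hT : MeasurePreserving T μ μ)
    {f : X → ℂ} (hf : MemLp f 2 μ) {ν : Measure UnitAddCircle} (hν : IsSpectralMeasure μ T f ν)
    (K : ℕ) : IsSpectralMeasure μ T (fun x => f (T.symm^[K] x)) ν := by
  refine ⟨hν.1, fun n => ?_⟩
  have hs : MeasurePreserving T.symm^[K] μ μ := (hT.symm T).iterate K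
  rw [hν.2, ← integral_comp_measurePreserving hs
    (integrable_mul_conj (memLp_iterate hT hf n) hf).aestronglyMeasurable]
  have hcomm : Function.Commute T.symm^[K] T^[n] :=
    Function.Commute.iterate_iterate (fun x => by simp) _ _
  simp_rw [hcomm.eq]

/-- **Spectral van der Corput theorem** for products: if the spectral measure of `f` is singular
and the correlations of the bounded sequence `u` vanish on average, then the averages of
`Tⁿf · uₙ` tend to zero in `L²`. -/
theorem tendsto_integral_norm_sq_average_zero [IsProbabilityMeasure μ] {T : X ≃ᵐ X}
    (hT : MeasurePreserving T μ μ) {f : X → ℂ} (hf : MemLp f ∞ μ) {ν : Measure UnitAddCircle}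
    (hν : IsSpectralMeasure μ T f ν) (hsing : ν ⟂ₘ volume) {u : ℕ → X → ℂ} {C : ℝ}
    (hm : ∀ n, AEStronglyMeasurable (u n) μ) (hC : ∀ n, ∀ᵐ x ∂μ, ‖u n x‖ ≤ C)
    (hu : ∀ h : ℕ, 1 ≤ h → Tendsto (fun N : ℕ => (N : ℂ)⁻¹ *
      ∑ n ∈ Finset.Icc 1 N, ∫ x, u (n + h) x * conj (u n x) ∂μ) atTop (𝓝 0)) :
    Tendsto (fun N : ℕ => ∫ x, ‖(N : ℂ)⁻¹ * ∑ n ∈ Finset.Icc 1 N, f (T^[n] x) * u n x‖ ^ 2 ∂μ)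
      atTop (𝓝 0) := by
  have hν1 := hν.1
  obtain ⟨D, hD⟩ : ∃ D : ℝ, ∀ᵐ x ∂μ, ‖f x‖ ≤ D := ⟨_, ae_le_lpNorm_exponent_top hf⟩
  have hf2 : MemLp f 2 μ := hf.mono_exponent le_top
  have main : ∀ ε : ℝ, 0 < ε → ∀ᶠ N : ℕ in atTop,
      ∫ x, ‖(N : ℂ)⁻¹ * ∑ n ∈ Finset.Icc 1 N, f (T^[n] x) * u n x‖ ^ 2 ∂μ ≤
        (2 * C ^ 2 + 4 * D ^ 2 * (C ^ 2 + 1)) * ε := by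
    intro ε hε
    obtain ⟨K, J, d, hKJ, hd1, hd2⟩ := exists_trigPoly_of_mutuallySingular hsing hε
    have hTs : MeasurePreserving T.symm^[K] μ μ := (hT.symm T).iterate K
    set F : X → ℂ := fun x => f (T.symm^[K] x) with hF
    have hFf : ∀ x, F (T^[K] x) = f x := fun x => by
      rw [hF]
      exact congrArg f (Function.LeftInverse.iterate T.symm_apply_apply K x)
    have hF2 : MemLp F 2 μ := hf2.comp_measurePreserving hTs
    have hFD : ∀ᵐ x ∂μ, ‖F x‖ ≤ D := hTs.quasiMeasurePreserving.ae hD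
    have hFDall : ∀ᵐ x ∂μ, ∀ n, ‖F (T^[n] x)‖ ≤ D :=
      ae_all_iff.2 fun n => (hT.iterate n).quasiMeasurePreserving.ae hFD
    -- The approximation error, small in `L²` by the isometry for the spectral measure of `F`.
    set e : X → ℂ := fun x => f x - ∑ j ∈ Finset.range J, d j * F (T^[j] x) with he
    have he2 : MemLp e 2 μ :=
      hf2.sub (memLp_finsetSum _ fun j _ => (memLp_iterate hT hF2 j).const_mul _)
    have heε : ∫ x, ‖e x‖ ^ 2 ∂μ ≤ ε := by
      have h := (isSpectralMeasure_comp_symm_iterate hT hf2 hν K).integral_norm_sq_sum hT hF2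
        (Finset.range J) (fun j => Pi.single (M := fun _ => ℂ) K 1 j - d j)
      have h' : ∀ a : ℕ → ℂ, ∑ j ∈ Finset.range J,
          (Pi.single (M := fun _ => ℂ) K 1 j - d j) * a j =
          a K - ∑ j ∈ Finset.range J, d j * a j := by
        intro a
        simp [sub_mul, Finset.sum_sub_distrib, Pi.single_apply, hKJ]
      calc _ = _ := by
            congr 1
            ext x
            rw [he, h' fun j => F (T^[j] x), hFf]
        _ = _ := h
        _ = _ := by
            congr 1
            ext θ
            rw [h' fun j => (fourier (j : ℤ) θ : ℂ)]
        _ ≤ ε := hd1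
    set W : ℕ → ℕ → X → ℂ := fun N m x =>
      ∑ j ∈ Finset.range J, d j * truncShift u N j m x with hW
    have hu2 : ∀ n, MemLp (u n) 2 μ := fun n => MemLp.of_bound (hm n) C (hC n)
    have hW2 : ∀ N m, MemLp (W N m) 2 μ := fun N m =>
      memLp_finsetSum _ fun j _ => (memLp_truncShift hu2 N j m).const_mul _
    have hsplit : ∀ (N : ℕ) (x : X), (N : ℂ)⁻¹ * ∑ n ∈ Finset.Icc 1 N, f (T^[n] x) * u n x =
        (N : ℂ)⁻¹ * ∑ n ∈ Finset.Icc 1 N, e (T^[n] x) * u n x +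
          (N : ℂ)⁻¹ * ∑ m ∈ Finset.range (N + J + 1), F (T^[m] x) * W N m x := by
      intro N x
      rw [hW, ← sum_mul_sum_shift u N J d (fun m => F (T^[m] x)) x, ← mul_add,
        ← Finset.sum_add_distrib]
      congr 1
      refine Finset.sum_congr rfl fun n _ => ?_
      rw [he, ← add_mul]
      congr 1
      simp_rw [← Function.iterate_add_apply, add_comm _ n]
      ring
    filter_upwards [eventually_ge_atTop (J + 1),
      eventually_sum_integral_norm_sq_truncShift_le hm hC hu J d hε] with N hN hR
    have hN0 : (0 : ℝ) < N := by exact_mod_cast (by omega : 0 < N)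
    set G : X → ℝ := fun x => 2 * C ^ 2 * ((N : ℝ)⁻¹ * ∑ n ∈ Finset.Icc 1 N, ‖e (T^[n] x)‖ ^ 2) +
      4 * D ^ 2 * ((N : ℝ)⁻¹ * ∑ m ∈ Finset.range (N + J + 1), ‖W N m x‖ ^ 2) with hG
    have hGe : Integrable (fun x => ∑ n ∈ Finset.Icc 1 N, ‖e (T^[n] x)‖ ^ 2) μ :=
      integrable_finsetSum _ fun n _ => (memLp_iterate hT he2 n).norm.integrable_sq
    have hGW : Integrable (fun x => ∑ m ∈ Finset.range (N + J + 1), ‖W N m x‖ ^ 2) μ :=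
      integrable_finsetSum _ fun m _ => (hW2 N m).norm.integrable_sq
    have hle : ∀ᵐ x ∂μ, ‖(N : ℂ)⁻¹ * ∑ n ∈ Finset.Icc 1 N, f (T^[n] x) * u n x‖ ^ 2 ≤ G x := by
      filter_upwards [hFDall, ae_all_iff.2 hC] with x hxF hxu
      rw [hsplit]
      have hA : ‖(N : ℂ)⁻¹ * ∑ n ∈ Finset.Icc 1 N, e (T^[n] x) * u n x‖ ^ 2 ≤
          C ^ 2 * ((N : ℝ)⁻¹ * ∑ n ∈ Finset.Icc 1 N, ‖e (T^[n] x)‖ ^ 2) := by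
        rw [norm_mul, norm_inv, Complex.norm_natCast, mul_pow]
        have hs : ∑ n ∈ Finset.Icc 1 N, ‖u n x‖ ^ 2 ≤ N * C ^ 2 := by
          refine (Finset.sum_le_sum fun n _ =>
            pow_le_pow_left₀ (norm_nonneg _) (hxu n) 2).trans ?_
          simp
        calc _ ≤ ((N : ℝ)⁻¹) ^ 2 * ((∑ n ∈ Finset.Icc 1 N, ‖e (T^[n] x)‖ ^ 2) * (N * C ^ 2)) := by
              gcongr
              exact (norm_sq_sum_mul_le _ _ _).trans (by gcongr)
          _ = _ := by field_simp
      have hB : ‖(N : ℂ)⁻¹ * ∑ m ∈ Finset.range (N + J + 1), F (T^[m] x) * W N m x‖ ^ 2 ≤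
          2 * D ^ 2 * ((N : ℝ)⁻¹ * ∑ m ∈ Finset.range (N + J + 1), ‖W N m x‖ ^ 2) := by
        rw [norm_mul, norm_inv, Complex.norm_natCast, mul_pow]
        have hs : ∑ m ∈ Finset.range (N + J + 1), ‖F (T^[m] x)‖ ^ 2 ≤ (2 * N) * D ^ 2 := by
          refine (Finset.sum_le_sum fun n _ =>
            pow_le_pow_left₀ (norm_nonneg _) (hxF n) 2).trans ?_
          rw [Finset.sum_const, Finset.card_range, nsmul_eq_mul]
          gcongr
          exact_mod_cast (by omega : N + J + 1 ≤ 2 * N)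
        calc _ ≤ ((N : ℝ)⁻¹) ^ 2 * ((2 * N * D ^ 2) *
                ∑ m ∈ Finset.range (N + J + 1), ‖W N m x‖ ^ 2) := by
              gcongr
              exact (norm_sq_sum_mul_le _ _ _).trans (by gcongr)
          _ = _ := by field_simp
      have hAB := norm_add_le ((N : ℂ)⁻¹ * ∑ n ∈ Finset.Icc 1 N, e (T^[n] x) * u n x)
        ((N : ℂ)⁻¹ * ∑ m ∈ Finset.range (N + J + 1), F (T^[m] x) * W N m x)
      have hAB2 := (pow_le_pow_left₀ (norm_nonneg _) hAB 2).trans (add_sq_le)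
      rw [hG]
      linarith
    calc _ ≤ ∫ x, G x ∂μ := integral_mono_of_nonneg (ae_of_all _ fun _ => by positivity)
          (((hGe.const_mul _).const_mul _).add ((hGW.const_mul _).const_mul _)) hle
      _ = 2 * C ^ 2 * ((N : ℝ)⁻¹ * ∑ n ∈ Finset.Icc 1 N, ∫ x, ‖e (T^[n] x)‖ ^ 2 ∂μ) +
          4 * D ^ 2 * ((N : ℝ)⁻¹ * ∑ m ∈ Finset.range (N + J + 1), ∫ x, ‖W N m x‖ ^ 2 ∂μ) := by
          rw [hG, integral_add ((hGe.const_mul _).const_mul _) ((hGW.const_mul _).const_mul _),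
            integral_const_mul, integral_const_mul, integral_const_mul, integral_const_mul,
            integral_finsetSum _ fun n _ => (memLp_iterate hT he2 n).norm.integrable_sq,
            integral_finsetSum _ fun m _ => (hW2 N m).norm.integrable_sq]
      _ ≤ 2 * C ^ 2 * ε + 4 * D ^ 2 * (ε * C ^ 2 + ε) := by
          gcongr
          · have h1 : ∀ n, ∫ x, ‖e (T^[n] x)‖ ^ 2 ∂μ = ∫ x, ‖e x‖ ^ 2 ∂μ := fun n =>
              integral_comp_measurePreserving (hT.iterate n)
                he2.norm.integrable_sq.aestronglyMeasurable
            simp_rw [h1]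
            rw [Finset.sum_const, Nat.card_Icc, nsmul_eq_mul, Nat.add_sub_cancel,
              inv_mul_cancel_left₀ hN0.ne']
            exact heε
          · exact hR.trans (by gcongr)
      _ = _ := by ring
  rw [Metric.tendsto_nhds]
  intro δ hδ
  set c : ℝ := 2 * C ^ 2 + 4 * D ^ 2 * (C ^ 2 + 1) with hc
  have hc0 : 0 ≤ c := by positivity
  filter_upwards [main (δ / (c + 1)) (by positivity)] with N hN
  rw [Real.dist_0_eq_abs, abs_of_nonneg (integral_nonneg fun _ => by positivity)]
  refine hN.trans_lt ?_
  rw [mul_div_assoc', div_lt_iff₀ (by positivity)]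
  linarith

end SpectralVdC

namespace SpectralVdC

/-! ### Invariant functions and the mean ergodic theorem -/

variable {X : Type*} [MeasurableSpace X] {μ : Measure X} {S : X → X}

theorem tendsto_eLpNorm_two_iff {ι : Type*} {l : Filter ι} {h : ι → X → ℂ}
    (hh : ∀ i, MemLp (h i) 2 μ) :
    Tendsto (fun i => eLpNorm (h i) 2 μ) l (𝓝 0) ↔
      Tendsto (fun i => ∫ x, ‖h i x‖ ^ 2 ∂μ) l (𝓝 0) := by
  have h1 : ∀ i, eLpNorm (h i) 2 μ = ENNReal.ofReal √(∫ x, ‖h i x‖ ^ 2 ∂μ) := fun i => by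
    rw [(hh i).eLpNorm_eq_integral_rpow_norm two_ne_zero (by simp), Real.sqrt_eq_rpow]
    simp
  have h0 : ∀ i, 0 ≤ ∫ x, ‖h i x‖ ^ 2 ∂μ := fun i => integral_nonneg fun _ => by positivity
  simp_rw [h1]
  constructor
  · intro h
    have h2 := ((ENNReal.tendsto_toReal ENNReal.zero_ne_top).comp h).pow 2
    simpa [Function.comp_def, ENNReal.toReal_ofReal, Real.sq_sqrt (h0 _)] using h2
  · intro h
    have h2 := ENNReal.tendsto_ofReal ((Real.continuous_sqrt.tendsto 0).comp h)
    simpa [Function.comp_def] using h2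

theorem measurable_invariants_of_comp_eq {β : Type*} [MeasurableSpace β] {φ : X → β}
    (hφ : Measurable φ) (h : φ ∘ S = φ) : Measurable[MeasurableSpace.invariants S] φ :=
  MeasurableSpace.measurable_invariants_dom.2 ⟨hφ, fun s _ => by rw [h]⟩

/-- An almost everywhere invariant real function agrees almost everywhere with its `limsup` along
orbits, which is strictly invariant. -/
theorem exists_measurable_invariants_ae_eq (hS : MeasurePreserving S μ μ) {φ : X → ℝ}
    (hφ : Measurable φ) (h : φ ∘ S =ᵐ[μ] φ) :
    ∃ ψ : X → ℝ, Measurable[MeasurableSpace.invariants S] ψ ∧ φ =ᵐ[μ] ψ := by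
  refine ⟨fun x => limsup (fun n : ℕ => φ (S^[n] x)) atTop, ?_, ?_⟩
  · refine measurable_invariants_of_comp_eq
      (Measurable.limsup fun n => hφ.comp (hS.iterate n).measurable) ?_
    ext x
    -- Passing from `x` to `S x` shifts the sequence by one.
    simp only [Function.comp_apply, ← Function.iterate_succ_apply]
    exact limsup_nat_add (fun n => φ (S^[n] x)) 1
  · have hall : ∀ᵐ x ∂μ, ∀ n : ℕ, φ (S (S^[n] x)) = φ (S^[n] x) :=
      ae_all_iff.2 fun n => (hS.iterate n).quasiMeasurePreserving.ae h
    filter_upwards [hall] with x hx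
    have hc : ∀ n : ℕ, φ (S^[n] x) = φ x := by
      intro n
      induction n with
      | zero => rfl
      | succ n ih => rw [Function.iterate_succ_apply', hx, ih]
    simp_rw [hc]
    exact limsup_const _ |>.symm

theorem aestronglyMeasurable_invariants (hS : MeasurePreserving S μ μ) {φ : X → ℂ}
    (hφ : Measurable φ) (h : φ ∘ S =ᵐ[μ] φ) :
    AEStronglyMeasurable[MeasurableSpace.invariants S] φ μ := by
  obtain ⟨a, ha, haφ⟩ := exists_measurable_invariants_ae_eq hS
    (Complex.measurable_re.comp hφ) (h.fun_comp Complex.re)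
  obtain ⟨b, hb, hbφ⟩ := exists_measurable_invariants_ae_eq hS
    (Complex.measurable_im.comp hφ) (h.fun_comp Complex.im)
  refine ⟨fun x => (a x : ℂ) + b x * Complex.I, ?_, ?_⟩
  · exact ((Complex.measurable_ofReal.comp ha).add
      ((Complex.measurable_ofReal.comp hb).mul_const _)).stronglyMeasurable
  · filter_upwards [haφ, hbφ] with x hx hy
    rw [← hx, ← hy]
    exact (Complex.re_add_im _).symm

/-- The twisted averages `(1/N) ∑_{n<N} ζ⁻ⁿ Sⁿg` (with `ζ⁻¹` written as the conjugate). -/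
noncomputable def twistedAverage (S : X → X) (ζ : ℂ) (g : X → ℂ) (N : ℕ) (x : X) : ℂ :=
  (N : ℂ)⁻¹ * ∑ n ∈ Finset.range N, conj ζ ^ n * g (S^[n] x)

theorem memLp_twistedAverage (hS : MeasurePreserving S μ μ) (ζ : ℂ) {g : X → ℂ}
    (hg : MemLp g 2 μ) (N : ℕ) : MemLp (twistedAverage S ζ g N) 2 μ :=
  (memLp_finsetSum _ fun n _ => (memLp_iterate hS hg n).const_mul _).const_mul _

/-- The mean ergodic theorem for the isometry `φ ↦ ζ⁻¹ • φ ∘ S` of `L²`: the limit `P` is the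
orthogonal projection of `g` to the eigenspace of `ζ`. -/
theorem exists_tendsto_twistedAverage (hS : MeasurePreserving S μ μ) {ζ : ℂ} (hζ : ‖ζ‖ = 1)
    {g : X → ℂ} (hg : MemLp g 2 μ) :
    ∃ P : X → ℂ, Measurable P ∧ MemLp P 2 μ ∧ (∀ᵐ x ∂μ, P (S x) = ζ * P x) ∧
      (∀ φ : X → ℂ, MemLp φ 2 μ → (∀ᵐ x ∂μ, φ (S x) = ζ * φ x) →
        ∫ x, (g x - P x) * conj (φ x) ∂μ = 0) ∧
      Tendsto (fun N => eLpNorm (fun x => twistedAverage S ζ g N x - P x) 2 μ) atTop (𝓝 0) := by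
  have hζζ : ζ * conj ζ = 1 := by rw [Complex.mul_conj', hζ]; simp
  set A : Lp ℂ 2 μ →L[ℂ] Lp ℂ 2 μ :=
    conj ζ • (Lp.compMeasurePreservingₗᵢ ℂ S hS).toContinuousLinearMap with hA
  have hA1 : ‖A‖ ≤ 1 := by
    refine ContinuousLinearMap.opNorm_le_bound _ zero_le_one fun y => ?_
    simp [hA, norm_smul, hζ]
  have hAv : ∀ y : Lp ℂ 2 μ, A y =ᵐ[μ] fun x => conj ζ * y (S x) := by
    intro y
    filter_upwards [Lp.coeFn_smul (conj ζ) (Lp.compMeasurePreserving S hS y),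
      Lp.coeFn_compMeasurePreserving y hS] with x h1 h2
    have h3 : A y = conj ζ • Lp.compMeasurePreserving S hS y := rfl
    rw [h3, h1, Pi.smul_apply, h2, smul_eq_mul, Function.comp_apply]
  have hiter : ∀ n : ℕ, A^[n] (hg.toLp g) =ᵐ[μ] fun x => conj ζ ^ n * g (S^[n] x) := by
    intro n
    induction n with
    | zero => simpa using hg.coeFn_toLp
    | succ n ih =>
      rw [Function.iterate_succ_apply']
      refine (hAv _).trans ?_
      filter_upwards [hS.quasiMeasurePreserving.ae ih] with x hx
      rw [hx, pow_succ', mul_assoc, Function.iterate_succ_apply]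
  set V := A.eqLocus (1 : Lp ℂ 2 μ →L[ℂ] Lp ℂ 2 μ) with hV
  have hlim := A.tendsto_birkhoffAverage_orthogonalProjection hA1 (hg.toLp g)
  set y : Lp ℂ 2 μ := (V.orthogonalProjectionOnto (hg.toLp g) : Lp ℂ 2 μ) with hy
  have hyV : y ∈ V := SetLike.coe_mem _
  refine ⟨y, (Lp.stronglyMeasurable y).measurable, Lp.memLp y, ?_, ?_, ?_⟩
  · have h1 : A y = y := hyV
    filter_upwards [hAv y] with x hx
    rw [h1] at hx
    rw [hx, ← mul_assoc, hζζ, one_mul]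
  · intro φ hφ hφS
    have hφV : hφ.toLp φ ∈ V := by
      change A (hφ.toLp φ) = hφ.toLp φ
      apply Lp.ext
      filter_upwards [hAv (hφ.toLp φ), hS.quasiMeasurePreserving.ae hφ.coeFn_toLp,
        hφ.coeFn_toLp, hφS] with x h1 h2 h3 h4
      rw [h1, h2, h3, h4, ← mul_assoc, mul_comm (conj ζ), hζζ, one_mul]
    have horth : inner ℂ (hφ.toLp φ) (hg.toLp g - y) = 0 :=
      V.sub_starProjection_mem_orthogonal (hg.toLp g) _ hφV
    rw [L2.inner_def] at horth
    rw [← horth]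
    refine integral_congr_ae ?_
    filter_upwards [hφ.coeFn_toLp, hg.coeFn_toLp, Lp.coeFn_sub (hg.toLp g) y] with x h1 h2 h3
    rw [h1, h3, Pi.sub_apply, h2, RCLike.inner_apply]
  · rw [Lp.tendsto_Lp_iff_tendsto_eLpNorm'] at hlim
    refine hlim.congr fun N => eLpNorm_congr_ae ?_
    have hav : ⇑(birkhoffAverage ℂ A (id : Lp ℂ 2 μ → Lp ℂ 2 μ) N (hg.toLp g)) =ᵐ[μ]
        twistedAverage S ζ g N := by
      rw [birkhoffAverage, birkhoffSum]
      refine (Lp.coeFn_smul _ _).trans ?_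
      have hs : ⇑(∑ k ∈ Finset.range N, id (A^[k] (hg.toLp g))) =ᵐ[μ]
          fun x => ∑ n ∈ Finset.range N, conj ζ ^ n * g (S^[n] x) := by
        induction N with
        | zero =>
          simp only [Finset.range_zero, Finset.sum_empty]
          exact Lp.coeFn_zero ℂ 2 μ
        | succ N ih =>
          rw [Finset.sum_range_succ]
          filter_upwards [ih, hiter N, Lp.coeFn_add (∑ k ∈ Finset.range N,
            id (A^[k] (hg.toLp g))) (id (A^[N] (hg.toLp g)))] with x h1 h2 h3
          rw [h3, Pi.add_apply, h1, id, h2, Finset.sum_range_succ]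
      filter_upwards [hs] with x hx
      rw [Pi.smul_apply, hx]
      rfl
    filter_upwards [hav] with x hx
    rw [Pi.sub_apply, hx]

/-- If `g` is orthogonal to the `e(θ₀)`-eigenfunctions of `S`, then its spectral measure has no
atom at `θ₀`. -/
theorem IsSpectralMeasure.measure_singleton_eq_zero {ν : Measure UnitAddCircle}
    (hS : MeasurePreserving S μ μ) {g : X → ℂ} (hg : MemLp g 2 μ)
    (hν : IsSpectralMeasure μ S g ν) (θ₀ : UnitAddCircle)
    (horth : ∀ φ : X → ℂ, Measurable φ → MemLp φ 2 μ →
      (∀ᵐ x ∂μ, φ (S x) = fourier 1 θ₀ * φ x) → ∫ x, g x * conj (φ x) ∂μ = 0) :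
    ν {θ₀} = 0 := by
  have hν1 := hν.1
  set ζ : ℂ := fourier 1 θ₀ with hζ
  have hζ1 : ‖ζ‖ = 1 := by rw [hζ, fourier_apply, Circle.norm_coe]
  obtain ⟨P, hPm, hP2, hPS, hPorth, hlim⟩ := exists_tendsto_twistedAverage hS hζ1 hg
  have hP0 : ∀ᵐ x ∂μ, P x = 0 := by
    have h1 := hPorth P hP2 hPS
    simp_rw [sub_mul] at h1
    rw [integral_sub (integrable_mul_conj hg hP2) (integrable_mul_conj hP2 hP2),
      horth P hPm hP2 hPS, zero_sub, neg_eq_zero] at h1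
    simp_rw [Complex.mul_conj', ← Complex.ofReal_pow] at h1
    rw [integral_complex_ofReal, Complex.ofReal_eq_zero, integral_eq_zero_iff_of_nonneg
      (fun _ => by positivity) hP2.norm.integrable_sq] at h1
    filter_upwards [h1] with x hx
    simpa using hx
  have hlim2 : Tendsto (fun N => eLpNorm (twistedAverage S ζ g N) 2 μ) atTop (𝓝 0) := by
    refine hlim.congr fun N => eLpNorm_congr_ae ?_
    filter_upwards [hP0] with x hx
    rw [hx, sub_zero]
  rw [tendsto_eLpNorm_two_iff (memLp_twistedAverage hS ζ hg)] at hlim2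
  have hle : ∀ᶠ N : ℕ in atTop, ν.real {θ₀} ≤ ∫ x, ‖twistedAverage S ζ g N x‖ ^ 2 ∂μ := by
    filter_upwards [eventually_ge_atTop 1] with N hN
    have hN0 : (N : ℂ) ≠ 0 := by exact_mod_cast (by omega : N ≠ 0)
    have h1 := hν.integral_norm_sq_sum hS hg (Finset.range N) fun n => (N : ℂ)⁻¹ * conj ζ ^ n
    simp_rw [mul_assoc, ← Finset.mul_sum] at h1
    have h2 : ∀ x, twistedAverage S ζ g N x =
      (N : ℂ)⁻¹ * ∑ n ∈ Finset.range N, conj ζ ^ n * g (S^[n] x) := fun _ => rfl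
    simp_rw [h2]
    rw [h1]
    -- The trigonometric polynomial of the twisted average equals `1` at `θ₀`, so its mean square
    -- bounds the mass of that point.
    set F : UnitAddCircle → ℝ := fun θ =>
      ‖(N : ℂ)⁻¹ * ∑ n ∈ Finset.range N, conj ζ ^ n * (fourier (n : ℤ) θ : ℂ)‖ ^ 2 with hF
    have hFc : Continuous F := by fun_prop
    have hFθ : F θ₀ = 1 := by
      have h3 : ∀ n : ℕ, conj ζ ^ n * (fourier (n : ℤ) θ₀ : ℂ) = 1 := by
        intro n
        have h4 : (fourier (n : ℤ) θ₀ : ℂ) = ζ ^ n := by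
          rw [hζ]
          simp [fourier_apply, AddCircle.toCircle_nsmul]
        rw [h4, ← mul_pow, mul_comm, Complex.mul_conj', hζ1]
        simp
      simp only [hF, h3]
      rw [Finset.sum_const, Finset.card_range, nsmul_eq_mul, mul_one, inv_mul_cancel₀ hN0]
      simp
    calc ν.real {θ₀} = ∫ θ in {θ₀}, F θ ∂ν := by
          rw [integral_singleton, hFθ, smul_eq_mul, mul_one]
      _ ≤ ∫ θ, F θ ∂ν := setIntegral_le_integral
          (hFc.integrable_of_hasCompactSupport (HasCompactSupport.of_compactSpace _))
          (ae_of_all _ fun _ => by positivity)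
  have h0 := ge_of_tendsto hlim2 hle
  exact (measureReal_eq_zero_iff).1 (le_antisymm h0 measureReal_nonneg)

/-- The **mean ergodic theorem** with the limit expressed as a conditional expectation. -/
theorem tendsto_eLpNorm_average_sub_condExp [IsFiniteMeasure μ] (hS : MeasurePreserving S μ μ)
    {g : X → ℂ} (hg : MemLp g 2 μ) :
    Tendsto (fun N : ℕ => eLpNorm (fun x => (N : ℂ)⁻¹ * ∑ n ∈ Finset.Icc 1 N, g (S^[n] x) -
      (μ[g | MeasurableSpace.invariants S]) x) 2 μ) atTop (𝓝 0) := by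
  obtain ⟨P, hPm, hP2, hPS, hPorth, hlim⟩ :=
    exists_tendsto_twistedAverage hS (ζ := 1) (by simp) hg
  simp only [one_mul] at hPS hPorth
  have hle := MeasurableSpace.invariants_le S
  have hPE : P =ᵐ[μ] μ[g | MeasurableSpace.invariants S] := by
    have hPi := hP2.integrable one_le_two
    have hgi := hg.integrable one_le_two
    refine ae_eq_condExp_of_forall_setIntegral_eq hle hgi (fun _ _ _ => hPi.integrableOn) ?_
      (aestronglyMeasurable_invariants hS hPm hPS)
    intro s hs _
    have h1 := hPorth (s.indicator fun _ => 1) (memLp_indicator_const _ (hle _ hs) _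
      (Or.inr (measure_ne_top _ _))) (ae_of_all _ fun x => by
        have : S ⁻¹' s = s := hs.2
        have hx : S x ∈ s ↔ x ∈ s := by rw [← Set.mem_preimage, this]
        by_cases h : x ∈ s <;> simp [h, hx])
    have h2 : ∀ x, (g x - P x) * conj (s.indicator (fun _ => (1 : ℂ)) x) =
        s.indicator (fun x => g x - P x) x := by
      intro x
      by_cases h : x ∈ s <;> simp [h]
    simp_rw [h2] at h1
    rw [integral_indicator (hle _ hs), integral_sub hgi.integrableOn hPi.integrableOn,
      sub_eq_zero] at h1
    exact h1.symm
  -- Composition with `S` turns the sum over `0, …, N - 1` into the sum over `1, …, N`.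
  refine hlim.congr fun N => ?_
  change eLpNorm (twistedAverage S 1 g N - P) 2 μ = _
  rw [← eLpNorm_comp_measurePreserving
    ((memLp_twistedAverage hS 1 hg N).sub hP2).aestronglyMeasurable hS]
  refine eLpNorm_congr_ae ?_
  filter_upwards [hPS, hPE] with x h1 h2
  simp only [Function.comp_apply, twistedAverage, map_one, one_pow, one_mul, Pi.sub_apply]
  simp_rw [← Function.iterate_succ_apply]
  rw [h1, h2, Finset.range_eq_Ico, Finset.sum_Ico_add' (fun n => g (S^[n] x)) 0 N 1]
  rfl

end SpectralVdC

namespace SpectralVdC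

/-! ### Uniform distribution and correlations -/

theorem fourier_one_differenceSeq (k : ℕ → ℕ) (h : ℕ) (α : ℝ) (n : ℕ) :
    (fourier 1 (differenceSeq k h α n) : ℂ) =
      fourier ((k (n + h) : ℤ) - k n) (α : UnitAddCircle) := by
  have : differenceSeq k h α n = ((k (n + h) : ℤ) - k n) • (α : UnitAddCircle) := by
    rw [differenceSeq, ← AddCircle.coe_zsmul, zsmul_eq_mul]
    push_cast
    rfl
  rw [this, fourier_apply, fourier_apply, one_zsmul]

/-- The Haar measure of a nontrivial orbit closure integrates the basic character to zero, as
translation by `α` multiplies the integral by `e(α) ≠ 1`. -/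
theorem integral_fourier_one_orbitHaar {α : ℝ} (hα : (α : UnitAddCircle) ≠ 0) :
    ∫ y, (fourier 1 y : ℂ) ∂(orbitHaar α) = 0 := by
  set H := orbitClosure α
  have hemb : MeasurableEmbedding ((↑) : H → UnitAddCircle) :=
    MeasurableEmbedding.subtype_coe
      (AddSubgroup.isClosed_topologicalClosure _).measurableSet
  have hmem : (α : UnitAddCircle) ∈ H :=
    AddSubgroup.le_topologicalClosure _ (AddSubgroup.mem_zmultiples _)
  rw [orbitHaar, hemb.integral_map]
  set m := Measure.addHaarMeasure (⊤ : TopologicalSpace.PositiveCompacts H)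
  have h1 := integral_add_left_eq_self (μ := m) (fun y : H => (fourier 1 (y : UnitAddCircle) : ℂ))
    ⟨α, hmem⟩
  have h2 : ∀ y : H, (fourier 1 (((⟨α, hmem⟩ + y : H)) : UnitAddCircle) : ℂ) =
      fourier 1 (α : UnitAddCircle) * fourier 1 (y : UnitAddCircle) := by
    intro y
    simp [fourier_apply, AddCircle.toCircle_add]
  simp_rw [h2] at h1
  rw [integral_const_mul] at h1
  have h3 : (fourier 1 (α : UnitAddCircle) : ℂ) ≠ 1 := by
    intro h
    apply hα
    rw [fourier_one, Circle.coe_eq_one] at h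
    exact AddCircle.injective_toCircle one_ne_zero (by rw [h, AddCircle.toCircle_zero])
  by_contra h
  exact h3 (mul_right_cancel₀ h (h1.trans (one_mul _).symm))

variable {X : Type*} [MeasurableSpace X] {μ : Measure X} {T S : X → X}

/-- The exponential sums `∑ e((k_{n+h} - k_n) θ)` of all difference sequences of `k` vanish on
average at the point `θ`. Only the basic character is tested, so this is weaker than
equidistribution of the differences. -/
def DifferencesEquidistributed (k : ℕ → ℕ) (θ : UnitAddCircle) : Prop :=
  ∀ h : ℕ, 1 ≤ h → Tendsto (fun N : ℕ => (N : ℂ)⁻¹ *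
    ∑ n ∈ Finset.Icc 1 N, (fourier ((k (n + h) : ℤ) - k n) θ : ℂ)) atTop (𝓝 0)

theorem IsSpectralMeasure.tendsto_correlation_zero {ν : Measure UnitAddCircle} {g : X → ℂ}
    (hS : MeasurePreserving S μ μ) (hg : MemLp g 2 μ) (hν : IsSpectralMeasure μ S g ν)
    {k : ℕ → ℕ} (hk : ∀ᵐ θ ∂ν, DifferencesEquidistributed k θ) {h : ℕ} (hh : 1 ≤ h) :
    Tendsto (fun N : ℕ => (N : ℂ)⁻¹ * ∑ n ∈ Finset.Icc 1 N,
      ∫ x, g (S^[k (n + h)] x) * conj (g (S^[k n] x)) ∂μ) atTop (𝓝 0) := by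
  have hν1 := hν.1
  have hint : ∀ n : ℕ, Integrable (fun θ => (fourier ((k (n + h) : ℤ) - k n) θ : ℂ)) ν := fun n =>
    (memLp_continuousMap ν _ 1).integrable le_rfl
  have h1 : Tendsto (fun N : ℕ => ∫ θ, (N : ℂ)⁻¹ *
      ∑ n ∈ Finset.Icc 1 N, (fourier ((k (n + h) : ℤ) - k n) θ : ℂ) ∂ν) atTop
      (𝓝 (∫ _, (0 : ℂ) ∂ν)) := by
    refine tendsto_integral_of_dominated_convergence (fun _ => 1) (fun N => ?_)
      (integrable_const _) (fun N => ae_of_all _ fun θ => ?_) ?_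
    · exact ((integrable_finsetSum _ fun n _ => hint n).const_mul _).aestronglyMeasurable
    · have h2 : ‖∑ n ∈ Finset.Icc 1 N, (fourier ((k (n + h) : ℤ) - k n) θ : ℂ)‖ ≤ N := by
        refine (norm_sum_le_of_le (n := fun _ => (1 : ℝ)) _ fun n _ => ?_).trans (by simp)
        rw [fourier_apply, Circle.norm_coe]
      rw [norm_mul, norm_inv, Complex.norm_natCast]
      rcases Nat.eq_zero_or_pos N with rfl | hN
      · simp
      · rwa [inv_mul_le_iff₀ (by exact_mod_cast hN), mul_one]
    · filter_upwards [hk] with θ hθ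
      exact hθ h hh
  rw [integral_zero] at h1
  refine h1.congr fun N => ?_
  rw [integral_const_mul, integral_finsetSum _ fun n _ => hint n]
  simp_rw [hν.integral_iterate_mul_conj hS hg]

theorem differencesEquidistributed_of_orbitHaar {k : ℕ → ℕ}
    (hk : ∀ α : ℝ, ∀ h : ℕ, 1 ≤ h →
      UniformlyDistributed (orbitHaar α) (differenceSeq k h α)) {θ : UnitAddCircle} (hθ : θ ≠ 0) :
    DifferencesEquidistributed k θ := by
  intro h hh
  obtain ⟨α, rfl⟩ := QuotientAddGroup.mk_surjective θ
  have h1 := hk α h hh (fourier 1)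
  rw [integral_fourier_one_orbitHaar hθ] at h1
  simp_rw [fourier_one_differenceSeq] at h1
  exact h1

theorem differencesEquidistributed_of_irrational {k : ℕ → ℕ}
    (hk : ∀ α : ℝ, Irrational α → ∀ h : ℕ, 1 ≤ h →
      UniformlyDistributed volume (differenceSeq k h α)) {α : ℝ} (hα : Irrational α) :
    DifferencesEquidistributed k (α : UnitAddCircle) := by
  intro h hh
  have h1 := hk α hα h hh (fourier 1)
  rw [integral_fourier_eq_ite, if_neg one_ne_zero] at h1
  simp_rw [fourier_one_differenceSeq] at h1
  exact h1

/-! ### Conditional expectations and convergence of the product averages -/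

/-- A function with vanishing conditional expectation is orthogonal to all `m`-measurable ones. -/
theorem integral_mul_conj_eq_zero_of_condExp {Y : Type*} {m m0 : MeasurableSpace Y}
    {μ : Measure Y} [IsFiniteMeasure μ] (hm : m ≤ m0) {g φ : Y → ℂ} (hg : MemLp g 2 μ)
    (hφ : MemLp φ 2 μ) (hφm : AEStronglyMeasurable[m] φ μ) (h0 : μ[g | m] =ᵐ[μ] 0) :
    ∫ x, g x * conj (φ x) ∂μ = 0 := by
  have h1 := condExp_bilin_of_aestronglyMeasurable_right (m := m) (μ := μ) (f := g)
    (g := fun x => conj (φ x)) (ContinuousLinearMap.mul ℝ ℂ)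
    (Complex.continuous_conj.comp_aestronglyMeasurable hφm) (integrable_mul_conj hg hφ)
    (hg.integrable one_le_two)
  simp only [ContinuousLinearMap.mul_apply'] at h1
  rw [← integral_condExp hm]
  refine integral_eq_zero_of_ae (h1.trans ?_)
  filter_upwards [h0] with x hx
  rw [hx]
  simp

theorem condExp_sub_condExp_ae_eq_zero {Y : Type*} {m m' m0 : MeasurableSpace Y}
    {μ : Measure Y} [IsFiniteMeasure μ] (hm : m' ≤ m) (hm0 : m ≤ m0) {g : Y → ℂ}
    (hg : Integrable g μ) (h : μ[g | m] =ᵐ[μ] μ[g | m']) :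
    μ[fun x => g x - (μ[g | m']) x | m] =ᵐ[μ] 0 := by
  have h1 := condExp_sub hg (integrable_condExp (m := m') (f := g) (μ := μ)) m
  have h2 : μ[μ[g | m'] | m] = μ[g | m'] :=
    condExp_of_stronglyMeasurable hm0 (stronglyMeasurable_condExp.mono hm) integrable_condExp
  filter_upwards [h1, h] with x hx hx'
  change (μ[g - μ[g | m'] | m]) x = 0
  rw [hx, Pi.sub_apply, h2, hx', sub_self]

/-- The product averages converge as soon as almost every point of the spectrum of
`g - E[g | I_S]` is one at which the difference sequences of `k` are equidistributed. -/
theorem productAveragesConverge_of_ae_equidistributed [IsProbabilityMeasure μ] {T : X ≃ᵐ X}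
    (hT : MeasurePreserving T μ μ) (hS : MeasurePreserving S μ μ) (k : ℕ → ℕ) {f g : X → ℂ}
    (hf : MemLp f ∞ μ) (hg : MemLp g ∞ μ) (hsing : spectralMeasure μ T f ⟂ₘ volume)
    (hk : ∀ ν, IsSpectralMeasure μ S (fun x => g x - (μ[g | MeasurableSpace.invariants S]) x) ν →
      ∀ᵐ θ ∂ν, DifferencesEquidistributed k θ) :
    ProductAveragesConverge μ T S k f g := by
  set E := μ[g | MeasurableSpace.invariants S] with hE
  set g₀ : X → ℂ := fun x => g x - E x with hg₀
  have hEtop : MemLp E ∞ μ := hg.condExp le_top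
  have hg₀top : MemLp g₀ ∞ μ := hg.sub hEtop
  have hf2 : MemLp f 2 μ := hf.mono_exponent le_top
  have hg₀2 : MemLp g₀ 2 μ := hg₀top.mono_exponent le_top
  obtain ⟨ν, hν⟩ := exists_isSpectralMeasure hS hg₀2
  obtain ⟨C, hC⟩ : ∃ C : ℝ, ∀ᵐ x ∂μ, ‖g₀ x‖ ≤ C := ⟨_, ae_le_lpNorm_exponent_top hg₀top⟩
  obtain ⟨D, hD⟩ : ∃ D : ℝ, ∀ᵐ x ∂μ, ‖E x‖ ≤ D := ⟨_, ae_le_lpNorm_exponent_top hEtop⟩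
  -- The invariance of `E` holds everywhere, not only almost everywhere.
  have hES : E ∘ S = E := MeasurableSpace.comp_eq_of_measurable_invariants
    (stronglyMeasurable_condExp (m := MeasurableSpace.invariants S) (f := g) (μ := μ)).measurable
  have hESn : ∀ (n : ℕ) (x : X), E (S^[n] x) = E x := by
    intro n
    induction n with
    | zero => exact fun _ => rfl
    | succ n ih => exact fun x => (ih (S x)).trans (congrFun hES x)
  have hmem : ∀ N, MemLp (fun x => productAverage T S k f g₀ N x) 2 μ := fun N =>
    ((memLp_finsetSum _ fun n _ => (hg₀top.comp_measurePreserving (hS.iterate (k n))).mul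
      (hf2.comp_measurePreserving (hT.iterate n)))).const_mul _
  have hvdc : Tendsto (fun N => eLpNorm (productAverage T S k f g₀ N) 2 μ) atTop (𝓝 0) := by
    rw [tendsto_eLpNorm_two_iff hmem]
    exact tendsto_integral_norm_sq_average_zero hT hf
      (isSpectralMeasure_spectralMeasure hT hf2) hsing (u := fun n x => g₀ (S^[k n] x))
      (fun n => (memLp_iterate hS hg₀2 _).aestronglyMeasurable)
      (fun n => (hS.iterate _).quasiMeasurePreserving.ae hC)
      (fun h hh => hν.tendsto_correlation_zero hS hg₀2 (hk ν hν) hh)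
  have herg := tendsto_eLpNorm_average_sub_condExp hT hf2
  set A : ℕ → X → ℂ := fun N x => (N : ℂ)⁻¹ * ∑ n ∈ Finset.Icc 1 N, f (T^[n] x) -
      (μ[f | MeasurableSpace.invariants T]) x with hA
  have hA2 : ∀ N, MemLp (A N) 2 μ := fun N =>
    ((memLp_finsetSum _ fun n _ => memLp_iterate hT hf2 n).const_mul _).sub
      (hf2.condExp one_le_two)
  have hupper : Tendsto (fun N => eLpNorm (productAverage T S k f g₀ N) 2 μ +
      ENNReal.ofReal D * eLpNorm (A N) 2 μ) atTop (𝓝 0) := by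
    have := hvdc.add (ENNReal.Tendsto.const_mul herg (Or.inr ENNReal.ofReal_ne_top)
      (a := ENNReal.ofReal D))
    simpa using this
  refine tendsto_of_tendsto_of_tendsto_of_le_of_le tendsto_const_nhds hupper
    (fun _ => zero_le) fun N => ?_
  have hdecomp : (fun x => productAverage T S k f g N x -
      (μ[f | MeasurableSpace.invariants T]) x * E x) =
      productAverage T S k f g₀ N + fun x => A N x * E x := by
    ext x
    simp only [productAverage, Pi.add_apply, hA, hg₀, hESn, mul_sub, Finset.sum_sub_distrib,
      ← Finset.sum_mul]
    ring
  rw [hdecomp]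
  have hAE : AEStronglyMeasurable (fun x => A N x * E x) μ :=
    (hA2 N).aestronglyMeasurable.mul hEtop.aestronglyMeasurable
  refine (eLpNorm_add_le (hmem N).aestronglyMeasurable hAE (by norm_num)).trans ?_
  gcongr
  refine eLpNorm_le_mul_eLpNorm_of_ae_le_mul ?_ 2
  filter_upwards [hD] with x hx
  rw [norm_mul, mul_comm]
  gcongr

/-- Equidistribution in orbit closures fails to give cancellation only at `θ = 0`, and there
`g - E[g | I_S]` has no spectral mass. -/
theorem ae_differencesEquidistributed_of_orbitHaar [IsProbabilityMeasure μ]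
    (hS : MeasurePreserving S μ μ) {k : ℕ → ℕ}
    (hk : ∀ α : ℝ, ∀ h : ℕ, 1 ≤ h → UniformlyDistributed (orbitHaar α) (differenceSeq k h α))
    {g : X → ℂ} (hg : MemLp g ∞ μ) {ν : Measure UnitAddCircle}
    (hν : IsSpectralMeasure μ S (fun x => g x - (μ[g | MeasurableSpace.invariants S]) x) ν) :
    ∀ᵐ θ ∂ν, DifferencesEquidistributed k θ := by
  have hg2 : MemLp g 2 μ := hg.mono_exponent le_top
  have hg₀ := hg2.sub (hg2.condExp (m := MeasurableSpace.invariants S) one_le_two)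
  have hle := MeasurableSpace.invariants_le S
  have h0 : ν {0} = 0 := by
    refine hν.measure_singleton_eq_zero hS hg₀ 0 fun φ hφm hφ hφS => ?_
    refine integral_mul_conj_eq_zero_of_condExp hle hg₀ hφ
      (aestronglyMeasurable_invariants hS hφm ?_)
      (condExp_sub_condExp_ae_eq_zero le_rfl hle (hg2.integrable one_le_two) .rfl)
    filter_upwards [hφS] with x hx
    simpa using hx
  filter_upwards [measure_eq_zero_iff_ae_notMem.1 h0] with θ hθ
  exact differencesEquidistributed_of_orbitHaar hk hθ

theorem IsRationalEigenfunction.measurable_ratKronecker {φ : X → ℂ}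
    (hφ : IsRationalEigenfunction μ S φ) : Measurable[ratKronecker μ S] φ := by
  have h : MeasurableSpace.comap φ (borel ℂ) ≤ ratKronecker μ S :=
    le_iSup (fun φ : {φ : X → ℂ // IsRationalEigenfunction μ S φ} =>
      MeasurableSpace.comap φ.1 (borel ℂ)) ⟨φ, hφ⟩
  rw [← BorelSpace.measurable_eq] at h
  exact measurable_iff_comap_le.2 h

/-- The indicator of an invariant set is an eigenfunction with eigenvalue `1`. -/
theorem invariants_le_ratKronecker [IsFiniteMeasure μ] (S : X → X) :
    MeasurableSpace.invariants S ≤ ratKronecker μ S := by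
  intro s hs
  have hsm : MeasurableSet s := MeasurableSpace.invariants_le S _ hs
  have hpre : S ⁻¹' s = s := hs.2
  have hφ : IsRationalEigenfunction μ S (s.indicator fun _ => 1) :=
    ⟨measurable_const.indicator hsm,
      memLp_indicator_const _ hsm _ (Or.inr (measure_ne_top _ _)), 1, ⟨1, le_rfl, by simp⟩,
      ae_of_all _ fun x => by
        have hx : S x ∈ s ↔ x ∈ s := by rw [← Set.mem_preimage, hpre]
        by_cases h : x ∈ s <;> simp [h, hx]⟩
  have hs1 : s = (s.indicator fun _ => (1 : ℂ)) ⁻¹' {1} := by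
    ext x
    by_cases h : x ∈ s <;> simp [h]
  rw [hs1]
  exact hφ.measurable_ratKronecker (measurableSet_singleton 1)

/-- The exceptional points are now the rationals, at which `g - E[g | I_S]` has no spectral mass
because it is orthogonal to all rational eigenfunctions. -/
theorem ae_differencesEquidistributed_of_irrational [IsProbabilityMeasure μ]
    (hS : MeasurePreserving S μ μ) {k : ℕ → ℕ}
    (hk : ∀ α : ℝ, Irrational α → ∀ h : ℕ, 1 ≤ h →
      UniformlyDistributed volume (differenceSeq k h α))
    {g : X → ℂ} (hg : MemLp g ∞ μ)
    (hrat : μ[g | ratKronecker μ S] =ᵐ[μ] μ[g | MeasurableSpace.invariants S])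
    {ν : Measure UnitAddCircle}
    (hν : IsSpectralMeasure μ S (fun x => g x - (μ[g | MeasurableSpace.invariants S]) x) ν) :
    ∀ᵐ θ ∂ν, DifferencesEquidistributed k θ := by
  have hg2 : MemLp g 2 μ := hg.mono_exponent le_top
  have hg₀ := hg2.sub (hg2.condExp (m := MeasurableSpace.invariants S) one_le_two)
  have h0 : ∀ q : ℚ, ν {((q : ℝ) : UnitAddCircle)} = 0 := by
    intro q
    refine hν.measure_singleton_eq_zero hS hg₀ _ fun φ hφm hφ hφS => ?_
    have hroot : (fourier 1 ((q : ℝ) : UnitAddCircle) : ℂ) ^ q.den = 1 := by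
      have h1 : q.den • ((q : ℝ) : UnitAddCircle) = 0 := by
        rw [← AddCircle.coe_nsmul, AddCircle.coe_eq_zero_iff]
        refine ⟨q.num, ?_⟩
        rw [zsmul_eq_mul, mul_one, nsmul_eq_mul]
        exact_mod_cast (Rat.den_mul_eq_num q).symm
      rw [fourier_one, ← Circle.coe_pow, ← AddCircle.toCircle_nsmul, h1, AddCircle.toCircle_zero,
        Circle.coe_one]
    exact integral_mul_conj_eq_zero_of_condExp (ratKronecker_le μ S) hg₀ hφ
      (IsRationalEigenfunction.measurable_ratKronecker
        ⟨hφm, hφ, _, ⟨q.den, q.den_pos, hroot⟩, hφS⟩).aestronglyMeasurable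
      (condExp_sub_condExp_ae_eq_zero (invariants_le_ratKronecker S) (ratKronecker_le μ S)
        (hg2.integrable one_le_two) hrat)
  have hall : ∀ᵐ θ ∂ν, ∀ q : ℚ, θ ≠ ((q : ℝ) : UnitAddCircle) :=
    ae_all_iff.2 fun q => measure_eq_zero_iff_ae_notMem.1 (h0 q)
  filter_upwards [hall] with θ hθ
  obtain ⟨α, rfl⟩ := QuotientAddGroup.mk_surjective θ
  refine differencesEquidistributed_of_irrational hk ?_
  rintro ⟨q, hq⟩
  exact hθ q (by rw [hq])

end SpectralVdC

namespace SpectralVdC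

/-! ### A lower bound for products of conditional expectations -/

theorem three_le_mul_div_sq_add {m a b : ℝ} (hm : 0 < m) (ha : 0 < a) (hb : 0 < b) :
    3 ≤ a * b / m ^ 2 + m / a + m / b := by
  -- With `a = m r²`, `b = m t²` and `s = r t`, the claim follows from `r² + t² ≥ 2 s` and
  -- `s⁴ + 2 s - 3 s² = s (s - 1)² (s + 2)`.
  obtain ⟨r, hr, hra⟩ : ∃ r : ℝ, 0 < r ∧ a = m * r ^ 2 :=
    ⟨√(a / m), by positivity, by rw [Real.sq_sqrt (by positivity)]; field_simp⟩
  obtain ⟨t, ht, htb⟩ : ∃ t : ℝ, 0 < t ∧ b = m * t ^ 2 :=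
    ⟨√(b / m), by positivity, by rw [Real.sq_sqrt (by positivity)]; field_simp⟩
  have h1 : a * b / m ^ 2 + m / a + m / b = (r * t) ^ 2 + (r ^ 2 + t ^ 2) / (r * t) ^ 2 := by
    rw [hra, htb]
    field_simp
    ring
  have h3 : 0 ≤ r * t * (r * t - 1) ^ 2 * (r * t + 2) := by positivity
  rw [h1, ← sub_le_iff_le_add', le_div_iff₀ (by positivity)]
  nlinarith [sq_nonneg (r - t)]

section CondExp

variable {X : Type*} {m m₁ m₂ m0 : MeasurableSpace X} {μ : Measure X}

/-- Formally `∫ f / E[f | m] ≤ 1`; the term `ε` keeps the denominator away from zero. -/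
theorem integral_div_condExp_add_le_one [IsProbabilityMeasure μ] (hm : m ≤ m0) {f : X → ℝ}
    (hf : Integrable f μ) (hf0 : 0 ≤ᵐ[μ] f) {ε : ℝ} (hε : 0 < ε) :
    Integrable (fun x => f x / ((μ[f | m]) x + ε)) μ ∧
      ∫ x, f x / ((μ[f | m]) x + ε) ∂μ ≤ 1 := by
  set a := μ[f | m] with ha
  have ham : StronglyMeasurable[m] a := stronglyMeasurable_condExp
  have hh : StronglyMeasurable[m] fun x => (a x + ε)⁻¹ :=
    (ham.measurable.add_const ε).inv.stronglyMeasurable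
  have ha0 : 0 ≤ᵐ[μ] a := condExp_nonneg hf0
  have hint : Integrable (fun x => f x * (a x + ε)⁻¹) μ := by
    refine hf.mul_bdd (c := ε⁻¹) (hh.mono hm).aestronglyMeasurable ?_
    filter_upwards [ha0] with x hx
    have hx' : 0 ≤ a x := hx
    rw [norm_inv, Real.norm_of_nonneg (by positivity)]
    gcongr
    linarith
  refine ⟨hint, ?_⟩
  have h1 := condExp_mul_of_stronglyMeasurable_right hh hint hf
  calc ∫ x, f x / (a x + ε) ∂μ = ∫ x, (μ[f * fun x => (a x + ε)⁻¹ | m]) x ∂μ :=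
        (integral_condExp hm).symm
    _ ≤ ∫ _, (1 : ℝ) ∂μ := by
        refine integral_mono_ae integrable_condExp (integrable_const _) ?_
        filter_upwards [h1, ha0] with x hx hx0
        have hx0' : 0 ≤ a x := hx0
        rw [hx, Pi.mul_apply, ← div_eq_mul_inv, div_le_one (by positivity)]
        linarith
    _ = 1 := by simp

/-- For an event `A` and two σ-algebras, `∫_A E[1_A | m₁] E[1_A | m₂] ≥ μ(A)³`. This follows by
integrating over `A` the inequality of arithmetic and geometric means for the three numbers
`ab / μ(A)²`, `μ(A) / a`, `μ(A) / b`, where `a`, `b` are the conditional expectations, moved away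
from zero by `ε`. -/
theorem measureReal_pow_three_le [IsProbabilityMeasure μ] (hm₁ : m₁ ≤ m0) (hm₂ : m₂ ≤ m0)
    {A : Set X} (hA : MeasurableSet[m0] A) :
    μ.real A ^ 3 ≤ ∫ x, A.indicator (fun _ => (1 : ℝ)) x *
      ((μ[A.indicator fun _ => (1 : ℝ) | m₁]) x * (μ[A.indicator fun _ => (1 : ℝ) | m₂]) x) ∂μ := by
  set f : X → ℝ := A.indicator fun _ => 1 with hf
  have hfi : Integrable f μ := (integrable_const _).indicator hA
  have hf0 : ∀ x, 0 ≤ f x := Set.indicator_nonneg fun _ _ => zero_le_one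
  have hf1 : ∀ x, f x ≤ 1 := Set.indicator_le_self' (fun _ _ => zero_le_one)
  have hfA : ∫ x, f x ∂μ = μ.real A := by
    rw [hf, integral_indicator_const _ hA, smul_eq_mul, mul_one]
  have hbound : ∀ m' : MeasurableSpace X, m' ≤ m0 →
      ∀ᵐ x ∂μ, 0 ≤ (μ[f | m']) x ∧ (μ[f | m']) x ≤ 1 := by
    intro m' hm'
    have h1 := condExp_nonneg (m := m') (μ := μ) (f := f) (ae_of_all _ hf0)
    have h2 := condExp_mono (m := m') hfi (integrable_const (1 : ℝ)) (ae_of_all _ hf1)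
    rw [condExp_const hm'] at h2
    filter_upwards [h1, h2] with x hx hy using ⟨hx, hy⟩
  set a := μ[f | m₁]
  set b := μ[f | m₂]
  have ha := hbound m₁ hm₁
  have hb := hbound m₂ hm₂
  have ham : AEStronglyMeasurable a μ := (stronglyMeasurable_condExp.mono hm₁).aestronglyMeasurable
  have hbm : AEStronglyMeasurable b μ := (stronglyMeasurable_condExp.mono hm₂).aestronglyMeasurable
  have hint : Integrable (fun x => f x * (a x * b x)) μ := by
    refine hfi.mul_bdd (c := 1) (ham.mul hbm) ?_
    filter_upwards [ha, hb] with x hx hy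
    rw [norm_mul, Real.norm_of_nonneg hx.1, Real.norm_of_nonneg hy.1]
    exact mul_le_one₀ hx.2 hy.1 hy.2
  rcases measureReal_nonneg (μ := μ) (s := A) |>.eq_or_lt with h0 | hpos
  · rw [← h0]
    refine (by norm_num : (0 : ℝ) ^ 3 ≤ 0).trans (integral_nonneg_of_ae ?_)
    filter_upwards [ha, hb] with x hx hy
    exact mul_nonneg (hf0 x) (mul_nonneg hx.1 hy.1)
  set p := μ.real A
  have key : ∀ ε : ℝ, 0 < ε → p ^ 3 ≤ ∫ x, f x * (a x * b x) ∂μ + (2 * ε + ε ^ 2) := by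
    intro ε hε
    obtain ⟨hai, ha1⟩ := integral_div_condExp_add_le_one hm₁ hfi (ae_of_all _ hf0) hε
    obtain ⟨hbi, hb1⟩ := integral_div_condExp_add_le_one hm₂ hfi (ae_of_all _ hf0) hε
    have hle : ∀ᵐ x ∂μ, 3 * f x ≤ (f x * (a x * b x) + (2 * ε + ε ^ 2)) / p ^ 2 +
        (p * (f x / (a x + ε)) + p * (f x / (b x + ε))) := by
      filter_upwards [ha, hb] with x hx hy
      have h3 := three_le_mul_div_sq_add hpos (a := a x + ε) (b := b x + ε) (by linarith)
        (by linarith)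
      have h4 := mul_le_mul_of_nonneg_left h3 (hf0 x)
      have h5 : f x * ((a x + ε) * (b x + ε)) ≤ f x * (a x * b x) + (2 * ε + ε ^ 2) := by
        have : f x * (ε * a x + ε * b x + ε ^ 2) ≤ 1 * (ε * 1 + ε * 1 + ε ^ 2) := by
          have := hx.1
          have := hy.1
          gcongr
          exacts [hf1 x, hx.2, hy.2]
        linarith
      calc 3 * f x ≤ f x * ((a x + ε) * (b x + ε)) / p ^ 2 +
            (p * (f x / (a x + ε)) + p * (f x / (b x + ε))) := by
            refine (mul_comm _ _).trans_le (h4.trans_eq ?_)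
            ring
        _ ≤ _ := by gcongr
    have hi1 : Integrable (fun x => (f x * (a x * b x) + (2 * ε + ε ^ 2)) / p ^ 2) μ :=
      (hint.add (integrable_const _)).div_const _
    have h6 := integral_mono_ae (hfi.const_mul 3)
      (hi1.add ((hai.const_mul p).add (hbi.const_mul p))) hle
    rw [integral_const_mul, hfA, integral_add' hi1 ((hai.const_mul p).add (hbi.const_mul p)),
      integral_add' (hai.const_mul p) (hbi.const_mul p), integral_const_mul, integral_const_mul,
      integral_div, integral_add hint (integrable_const _)] at h6
    simp only [integral_const, probReal_univ, one_smul] at h6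
    have h7 : p ≤ (∫ x, f x * (a x * b x) ∂μ + (2 * ε + ε ^ 2)) / p ^ 2 := by nlinarith
    rw [le_div_iff₀ (by positivity)] at h7
    linarith
  have hlim : Tendsto (fun ε : ℝ => ∫ x, f x * (a x * b x) ∂μ + (2 * ε + ε ^ 2)) (𝓝[>] 0)
      (𝓝 (∫ x, f x * (a x * b x) ∂μ + (2 * 0 + 0 ^ 2))) := by
    refine Tendsto.mono_left (Continuous.tendsto ?_ _) nhdsWithin_le_nhds
    fun_prop
  have := ge_of_tendsto hlim (eventually_mem_nhdsWithin.mono key)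
  simpa using this

/-! ### Recurrence averages -/

theorem condExp_indicator_ofReal [IsFiniteMeasure μ] {A : Set X} (hA : MeasurableSet[m0] A) :
    μ[A.indicator fun _ => (1 : ℂ) | m] =ᵐ[μ]
      fun x => (((μ[A.indicator fun _ => (1 : ℝ) | m]) x : ℝ) : ℂ) := by
  have h1 := Complex.ofRealCLM.comp_condExp_comm (m := m)
    (((integrable_const (1 : ℝ)).indicator hA : Integrable (A.indicator fun _ => (1 : ℝ)) μ))
  have h2 : (Complex.ofRealCLM ∘ A.indicator fun _ => (1 : ℝ)) = A.indicator fun _ => (1 : ℂ) := by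
    ext x
    by_cases h : x ∈ A <;> simp [h]
  rw [h2] at h1
  exact h1.symm

end CondExp

theorem recurrenceAveragesLarge_of_productAveragesConverge {X : Type*} [MeasurableSpace X]
    {μ : Measure X} [IsProbabilityMeasure μ] {T S : X → X} (hT : MeasurePreserving T μ μ)
    (hS : MeasurePreserving S μ μ) (k : ℕ → ℕ) {A : Set X} (hA : MeasurableSet A)
    (h : ProductAveragesConverge μ T S k (A.indicator fun _ => 1) (A.indicator fun _ => 1)) :
    RecurrenceAveragesLarge μ T S k A := by
  set f : X → ℂ := A.indicator fun _ => 1 with hf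
  have hftop : MemLp f ∞ μ := memLp_indicator_const _ hA _ (Or.inr (measure_ne_top _ _))
  have hf2 : MemLp f 2 μ := hftop.mono_exponent le_top
  set a := μ[A.indicator fun _ => (1 : ℝ) | MeasurableSpace.invariants T] with ha
  set b := μ[A.indicator fun _ => (1 : ℝ) | MeasurableSpace.invariants S] with hb
  refine ⟨∫ x, A.indicator (fun _ => (1 : ℝ)) x * (a x * b x) ∂μ, ?_,
    measureReal_pow_three_le (MeasurableSpace.invariants_le T)
      (MeasurableSpace.invariants_le S) hA⟩
  set E : X → ℂ := fun x => (μ[f | MeasurableSpace.invariants T]) x *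
    (μ[f | MeasurableSpace.invariants S]) x with hE
  have hmem : ∀ N, MemLp (productAverage T S k f f N) 2 μ := fun N =>
    ((memLp_finsetSum _ fun n _ => (hftop.comp_measurePreserving (hS.iterate (k n))).mul
      (hf2.comp_measurePreserving (hT.iterate n)))).const_mul _
  have hEmem : MemLp E 2 μ := (hftop.condExp le_top).mul (hf2.condExp one_le_two)
  have hfle : ∀ x, ‖f x‖ ≤ 1 := fun x => by
    by_cases hx : x ∈ A <;> simp [hf, hx]
  have hfE : MemLp (fun x => f x * E x) 2 μ := hEmem.mul hftop
  have hfP : ∀ N, MemLp (fun x => f x * productAverage T S k f f N x) 2 μ := fun N =>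
    (hmem N).mul hftop
  have hlim : Tendsto (fun N => ∫ x, f x * productAverage T S k f f N x ∂μ) atTop
      (𝓝 (∫ x, f x * E x ∂μ)) := by
    refine tendsto_integral_of_L1' _ hfE.aestronglyMeasurable
      (Eventually.of_forall fun N => (hfP N).integrable one_le_two) ?_
    refine tendsto_of_tendsto_of_tendsto_of_le_of_le tendsto_const_nhds h
      (fun _ => zero_le) fun N => ?_
    refine (eLpNorm_le_eLpNorm_of_exponent_le one_le_two
      ((hfP N).sub hfE).aestronglyMeasurable).trans (eLpNorm_mono fun x => ?_)
    simp only [Pi.sub_apply, ← mul_sub, norm_mul]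
    exact mul_le_of_le_one_left (norm_nonneg _) (hfle x)
  have hre := (Complex.continuous_re.tendsto _).comp hlim
  have e1 : (∫ x, f x * E x ∂μ).re = ∫ x, A.indicator (fun _ => (1 : ℝ)) x * (a x * b x) ∂μ := by
    rw [← Complex.ofReal_re (∫ x, A.indicator (fun _ => (1 : ℝ)) x * (a x * b x) ∂μ),
      ← integral_complex_ofReal]
    congr 1
    refine integral_congr_ae ?_
    filter_upwards [condExp_indicator_ofReal (m := MeasurableSpace.invariants T) (μ := μ) hA,
      condExp_indicator_ofReal (m := MeasurableSpace.invariants S) (μ := μ) hA] with x h1 h2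
    simp only [hE]
    rw [h1, h2]
    by_cases hx : x ∈ A <;> simp [hf, hx, ha, hb]
  rw [e1] at hre
  refine hre.congr fun N => ?_
  have e2 : ∫ x, f x * productAverage T S k f f N x ∂μ = (((N : ℝ)⁻¹ *
      ∑ n ∈ Finset.Icc 1 N, μ.real (A ∩ T^[n] ⁻¹' A ∩ S^[k n] ⁻¹' A) : ℝ) : ℂ) := by
    have hpt : ∀ x, f x * productAverage T S k f f N x = (N : ℂ)⁻¹ * ∑ n ∈ Finset.Icc 1 N,
        (A ∩ T^[n] ⁻¹' A ∩ S^[k n] ⁻¹' A).indicator (fun _ => (1 : ℂ)) x := by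
      intro x
      rw [productAverage, mul_left_comm, Finset.mul_sum]
      congr 1
      refine Finset.sum_congr rfl fun n _ => ?_
      by_cases h1 : x ∈ A <;> by_cases h2 : T^[n] x ∈ A <;> by_cases h3 : S^[k n] x ∈ A <;>
        simp [hf, h1, h2, h3]
    have hms : ∀ n, MeasurableSet (A ∩ T^[n] ⁻¹' A ∩ S^[k n] ⁻¹' A) := fun n =>
      (hA.inter ((hT.iterate n).measurable hA)).inter ((hS.iterate (k n)).measurable hA)
    simp_rw [hpt]
    rw [integral_const_mul, integral_finsetSum _ fun n _ => (integrable_const _).indicator (hms n)]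
    push_cast
    congr 1
    refine Finset.sum_congr rfl fun n _ => ?_
    rw [integral_indicator_const _ (hms n)]
    simp
  rw [Function.comp_apply, e2, Complex.ofReal_re]

/-! ### Totally ergodic transformations -/

/-- The σ-algebra of sets that are null or have null complement. -/
@[reducible]
def aeTrivialSets {X : Type*} {m0 : MeasurableSpace X} (μ : Measure X) : MeasurableSpace X where
  MeasurableSet' s := μ s = 0 ∨ μ sᶜ = 0
  measurableSet_empty := Or.inl measure_empty
  measurableSet_compl s hs := by rwa [compl_compl, or_comm]
  measurableSet_iUnion s hs := by
    by_cases h : ∃ i, μ (s i)ᶜ = 0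
    · obtain ⟨i, hi⟩ := h
      exact Or.inr (measure_mono_null (Set.compl_subset_compl.2 (Set.subset_iUnion s i)) hi)
    · push Not at h
      exact Or.inl (measure_iUnion_null fun i => (hs i).resolve_right (h i))

theorem condExp_ae_eq_integral_of_le_aeTrivialSets {X : Type*} {m m0 : MeasurableSpace X}
    {μ : Measure X} [IsProbabilityMeasure μ] (hm : m ≤ m0)
    (htriv : m ≤ aeTrivialSets μ) {g : X → ℂ} (hg : Integrable g μ) :
    μ[g | m] =ᵐ[μ] fun _ => ∫ x, g x ∂μ := by
  refine (ae_eq_condExp_of_forall_setIntegral_eq hm hg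
    (fun _ _ _ => (integrable_const _).integrableOn) (fun s hs _ => ?_)
    aestronglyMeasurable_const).symm
  rcases htriv s hs with h | h
  · rw [Measure.restrict_eq_zero.2 h, integral_zero_measure, integral_zero_measure]
  · have h1 : s =ᵐ[μ] Set.univ := ae_eq_univ.2 h
    rw [setIntegral_congr_set h1, setIntegral_congr_set h1, setIntegral_univ, setIntegral_univ]
    simp

/-- A rational eigenfunction of `S` is invariant under a power of `S`, hence constant if that power
is ergodic. -/
theorem ratKronecker_le_aeTrivialSets {X : Type*} [MeasurableSpace X] {μ : Measure X} {S : X → X}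
    (hS : MeasurePreserving S μ μ) (h : TotallyErgodic μ S) :
    ratKronecker μ S ≤ aeTrivialSets μ := by
  refine iSup_le ?_
  rintro ⟨φ, hφm, -, ζ, ⟨q, hq, hζ⟩, hφS⟩
  have hiter : ∀ n : ℕ, ∀ᵐ x ∂μ, φ (S^[n] x) = ζ ^ n * φ x := by
    intro n
    induction n with
    | zero => simp
    | succ n ih =>
      filter_upwards [ih, (hS.iterate n).quasiMeasurePreserving.ae hφS] with x h1 h2
      rw [Function.iterate_succ_apply', h2, h1, pow_succ', mul_assoc]
  obtain ⟨c, hc⟩ := (h q hq).ae_eq_const_of_ae_eq_comp₀ hφm.nullMeasurable (by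
    filter_upwards [hiter q] with x hx
    rw [Function.comp_apply, hx, hζ, one_mul])
  rintro s ⟨t, -, rfl⟩
  by_cases hct : c ∈ t
  · right
    change μ {x | ¬ φ x ∈ t} = 0
    refine ae_iff.1 ?_
    filter_upwards [hc] with x hx
    rw [hx]
    exact hct
  · left
    rw [measure_eq_zero_iff_ae_notMem]
    filter_upwards [hc] with x hx
    rw [Set.mem_preimage, hx]
    exact hct

end SpectralVdC


/-! ### Convergence and recurrence -/

theorem mainTheorem3 {X : Type*} [MeasurableSpace X] (μ : Measure X) [IsProbabilityMeasure μ]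
    (T S : X ≃ᵐ X) (hT : MeasurePreserving T μ μ) (hS : MeasurePreserving S μ μ) (k : ℕ → ℕ) :
    -- uniform distribution in the orbit closure of every real number
    ((∀ α : ℝ, ∀ h : ℕ, 1 ≤ h →
        SpectralVdC.UniformlyDistributed (SpectralVdC.orbitHaar α)
          (SpectralVdC.differenceSeq k h α)) →
      (∀ f g : X → ℂ, MemLp f ∞ μ → MemLp g ∞ μ →
        SpectralVdC.spectralMeasure μ T f ⟂ₘ volume →
        SpectralVdC.ProductAveragesConverge μ T S k f g) ∧
      (∀ A : Set X, MeasurableSet A →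
        SpectralVdC.spectralMeasure μ T (A.indicator fun _ => 1) ⟂ₘ volume →
        SpectralVdC.RecurrenceAveragesLarge μ T S k A)) ∧
    -- uniform distribution for irrational numbers only
    ((∀ α : ℝ, Irrational α → ∀ h : ℕ, 1 ≤ h →
        SpectralVdC.UniformlyDistributed volume (SpectralVdC.differenceSeq k h α)) →
      (∀ f g : X → ℂ, MemLp f ∞ μ → MemLp g ∞ μ →
        SpectralVdC.spectralMeasure μ T f ⟂ₘ volume →
        μ[g | SpectralVdC.ratKronecker μ S] =ᵐ[μ] μ[g | MeasurableSpace.invariants S] →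
        SpectralVdC.ProductAveragesConverge μ T S k f g) ∧
      (∀ A : Set X, MeasurableSet A →
        SpectralVdC.spectralMeasure μ T (A.indicator fun _ => 1) ⟂ₘ volume →
        μ[(A.indicator fun _ => (1 : ℂ)) | SpectralVdC.ratKronecker μ S] =ᵐ[μ]
          μ[(A.indicator fun _ => (1 : ℂ)) | MeasurableSpace.invariants S] →
        SpectralVdC.RecurrenceAveragesLarge μ T S k A)) ∧
    -- the assumption on conditional expectations holds when `S` is totally ergodic
    (SpectralVdC.TotallyErgodic μ S → ∀ g : X → ℂ, MemLp g ∞ μ →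
      μ[g | SpectralVdC.ratKronecker μ S] =ᵐ[μ] μ[g | MeasurableSpace.invariants S]) := by
  have hprod₁ : (∀ α : ℝ, ∀ h : ℕ, 1 ≤ h →
        SpectralVdC.UniformlyDistributed (SpectralVdC.orbitHaar α)
          (SpectralVdC.differenceSeq k h α)) →
      ∀ f g : X → ℂ, MemLp f ∞ μ → MemLp g ∞ μ →
        SpectralVdC.spectralMeasure μ T f ⟂ₘ volume →
        SpectralVdC.ProductAveragesConverge μ T S k f g :=
    fun hk f g hf hg hsing =>
      SpectralVdC.productAveragesConverge_of_ae_equidistributed hT hS k hf hg hsing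
        fun ν hν => SpectralVdC.ae_differencesEquidistributed_of_orbitHaar hS hk hg hν
  have hprod₂ : (∀ α : ℝ, Irrational α → ∀ h : ℕ, 1 ≤ h →
        SpectralVdC.UniformlyDistributed volume (SpectralVdC.differenceSeq k h α)) →
      ∀ f g : X → ℂ, MemLp f ∞ μ → MemLp g ∞ μ →
        SpectralVdC.spectralMeasure μ T f ⟂ₘ volume →
        μ[g | SpectralVdC.ratKronecker μ S] =ᵐ[μ] μ[g | MeasurableSpace.invariants S] →
        SpectralVdC.ProductAveragesConverge μ T S k f g :=
    fun hk f g hf hg hsing hrat =>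
      SpectralVdC.productAveragesConverge_of_ae_equidistributed hT hS k hf hg hsing
        fun ν hν => SpectralVdC.ae_differencesEquidistributed_of_irrational hS hk hg hrat hν
  have hind : ∀ A : Set X, MeasurableSet A → MemLp (A.indicator fun _ => (1 : ℂ)) ∞ μ :=
    fun A hA => memLp_indicator_const _ hA _ (Or.inr (measure_ne_top _ _))
  refine ⟨fun hk => ⟨hprod₁ hk, fun A hA hsing => ?_⟩,
    fun hk => ⟨hprod₂ hk, fun A hA hsing hrat => ?_⟩, fun hS' g hg => ?_⟩
  · exact SpectralVdC.recurrenceAveragesLarge_of_productAveragesConverge hT hS k hA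
      (hprod₁ hk _ _ (hind A hA) (hind A hA) hsing)
  · exact SpectralVdC.recurrenceAveragesLarge_of_productAveragesConverge hT hS k hA
      (hprod₂ hk _ _ (hind A hA) (hind A hA) hsing hrat)
  · have htriv := SpectralVdC.ratKronecker_le_aeTrivialSets hS hS'
    have hgi := hg.integrable le_top
    exact (SpectralVdC.condExp_ae_eq_integral_of_le_aeTrivialSets
      (SpectralVdC.ratKronecker_le μ S) htriv hgi).trans
      (SpectralVdC.condExp_ae_eq_integral_of_le_aeTrivialSets (MeasurableSpace.invariants_le S)
        ((SpectralVdC.invariants_le_ratKronecker S).trans htriv) hgi).symm
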